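/- Let $K$ be a field of characteristic $0$, let $0\neq\delta\in K$, and for $r\ge 0$ let $B_r=B_r(\delta)$ be the Brauer algebra over $K$, with basis the Brauer diagrams on $r+r$ points (perfect matchings of $r$ top and $r$ bottom points), multiplied by concatenation, each closed loop being replaced by a factor $\delta$. Let $\Lambda_r$ be the set of partitions $\lambda$ with $|\lambda|\le r$ and $|\lambda|\equiv r \pmod 2$, so that $\Lambda_r\subset\Lambda_{r+2}$. For $\lambda\in\Lambda_r$ with $|\lambda|=t$, let $W_r(\lambda)=I_r^t\otimes_{K\mathrm{Sym}_t}S(\lambda)$ be the cell module, where $S(\lambda)$ is the Specht module and $I_r^t$ is the $(B_r,K\mathrm{Sym}_t)$-bimodule of $K$-linear combinations of diagrams with $r$ top and $t$ bottom points, modulo those with fewer than $t$ through strings. Let $(-,-)_\lambda$ be the canonical symmetric bilinear form on $W_r(\lambda)$, given by $(x\otimes s,\,y\otimes u)_\lambda=(s,(x^*y)u)_{S(\lambda)}$, where $x^*$ is the reflection of $x$ in a horizontal line, $x^*y$ acts on $S(\lambda)$ modulo diagrams with fewer than $t$ through strings, and $(-,-)_{S(\lambda)}$ is the restriction to $S(\lambda)$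 of the form for which the tabloids are orthonormal. Let $\mathrm{Rad}_r(\lambda)$ be the radical of $(-,-)_\lambda$ and $L_r(\lambda)=W_r(\lambda)/\mathrm{Rad}_r(\lambda)$. Then for all $r\ge 0$ and all $\mu,\lambda\in\Lambda_r$: $L_r(\mu)$ is a composition factor of the $B_r$-module $W_r(\lambda)$ if and only if $L_{r+2}(\mu)$ is a composition factor of the $B_{r+2}$-module $W_{r+2}(\lambda)$. -/

import Mathlib

/-- A Brauer diagram with `m` points on its top row and `n` points on its bottom row: a graph on
these points in which every point lies on exactly one edge. -/
@[ext]
structure BrauerDiagram (m n : ℕ) where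
  graph : SimpleGraph (Fin m ⊕ Fin n)
  existsUnique_adj : ∀ v, ∃! w, graph.Adj v w

namespace BrauerDiagram

variable {m n p q : ℕ}

/-- Inclusion of the points of the upper diagram into the points of a stack of two diagrams. -/
def upper : Fin m ⊕ Fin n ↪ Fin m ⊕ (Fin n ⊕ Fin p) where
  toFun := Sum.map id Sum.inl
  inj' := Function.injective_id.sumMap Sum.inl_injective

/-- Inclusion of the points of the lower diagram into the points of a stack of two diagrams. -/
def lower : Fin n ⊕ Fin p ↪ Fin m ⊕ (Fin n ⊕ Fin p) where
  toFun := Sum.inr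
  inj' := Sum.inr_injective

/-- Inclusion of the top and bottom rows into the points of a stack of two diagrams. -/
def outer : Fin m ⊕ Fin p ↪ Fin m ⊕ (Fin n ⊕ Fin p) where
  toFun := Sum.map id Sum.inr
  inj' := Function.injective_id.sumMap Sum.inr_injective

/-- The graph obtained by placing `a` above `b`, the bottom row of `a` being identified with the
top row of `b`. -/
def stack (a : BrauerDiagram m n) (b : BrauerDiagram n p) :
    SimpleGraph (Fin m ⊕ (Fin n ⊕ Fin p)) :=
  a.graph.map upper ⊔ b.graph.map lower

/-- The number of closed loops of the stack of `a` and `b`: of its connected components that meet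
neither the top nor the bottom row. -/
noncomputable def loops (a : BrauerDiagram m n) (b : BrauerDiagram n p) : ℕ :=
  Nat.card {C : (stack a b).ConnectedComponent //
    ∀ v, (stack a b).connectedComponentMk (outer v) ≠ C}

theorem adj_unique (d : BrauerDiagram m n) {u v w : Fin m ⊕ Fin n} (h : d.graph.Adj u v)
    (h' : d.graph.Adj u w) : v = w :=
  (d.existsUnique_adj u).unique h h'

theorem stack_adj {a : BrauerDiagram m n} {b : BrauerDiagram n p}
    {u v : Fin m ⊕ (Fin n ⊕ Fin p)} : (stack a b).Adj u v ↔
      (∃ x y, a.graph.Adj x y ∧ upper x = u ∧ upper y = v) ∨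
      (∃ x y, b.graph.Adj x y ∧ lower x = u ∧ lower y = v) := by
  simp [stack, SimpleGraph.map_adj]

theorem even_sum (d : BrauerDiagram m n) (P : Fin m ⊕ Fin n → Prop) [DecidablePred P]
    (hP : ∀ u v, d.graph.Adj u v → P u → P v) :
    Even (∑ v, if P v then 1 else 0 : ℕ) := by
  rw [← ZMod.natCast_eq_zero_iff_even]
  push_cast
  choose f hf _ using d.existsUnique_adj
  refine Finset.sum_ninvolution f (fun v => ?_) (fun v _ => (hf v).ne')
    (fun _ => Finset.mem_univ _) (fun v => d.adj_unique (hf (f v)) (hf v).symm)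
  have : P (f v) ↔ P v := ⟨hP _ _ (hf v).symm, hP _ _ (hf v)⟩
  by_cases h : P v
  · simp [this, h]; decide
  · simp [this, h]

open Classical in
theorem card_outer (a : BrauerDiagram m n) (b : BrauerDiagram n p)
    (C : (stack a b).ConnectedComponent) :
    Even (∑ v : Fin m ⊕ Fin p,
      if (stack a b).connectedComponentMk (outer v) = C then 1 else 0 : ℕ) ∧
    (∑ v : Fin m ⊕ Fin p,
      if (stack a b).connectedComponentMk (outer v) = C then 1 else 0 : ℕ) ≤ 2 := by
  set mk := (stack a b).connectedComponentMk with hmk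
  have hU := even_sum a (fun v => mk (upper v) = C) (by
    intro u v h hu
    rw [← hu, hmk, SimpleGraph.ConnectedComponent.eq]
    exact (stack_adj.2 (Or.inl ⟨_, _, h, rfl, rfl⟩)).symm.reachable)
  have hL := even_sum b (fun v => mk (lower v) = C) (by
    intro u v h hu
    rw [← hu, hmk, SimpleGraph.ConnectedComponent.eq]
    exact (stack_adj.2 (Or.inr ⟨_, _, h, rfl, rfl⟩)).symm.reachable)
  have hV : Nat.card C = ∑ v, if mk v = C then 1 else 0 := by
    rw [Nat.card_eq_fintype_card, ← Finset.card_filter]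
    exact Fintype.card_of_subtype _ (fun v => by simp [hmk]; rfl)
  have h1 := C.connected_toSimpleGraph.card_vert_le_card_edgeSet_add_one
  have h2 := C.toSimpleGraph.dart_card_eq_twice_card_edges
  have h3 : Fintype.card C.toSimpleGraph.Dart ≤
      Fintype.card ({v : Fin m ⊕ Fin n // mk (upper v) = C} ⊕
        {v : Fin n ⊕ Fin p // mk (lower v) = C}) := by
    let R : C.toSimpleGraph.Dart → ({v : Fin m ⊕ Fin n // mk (upper v) = C} ⊕
        {v : Fin n ⊕ Fin p // mk (lower v) = C}) → Prop := fun d s =>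
      Sum.elim (fun x => ∃ y, a.graph.Adj x.1 y ∧ upper x.1 = d.fst.1 ∧ upper y = d.snd.1)
        (fun x => ∃ y, b.graph.Adj x.1 y ∧ lower x.1 = d.fst.1 ∧ lower y = d.snd.1) s
    have hR : ∀ d, ∃ s, R d s := by
      intro d
      have hd : (stack a b).Adj d.fst.1 d.snd.1 := d.adj
      have hC : mk d.fst.1 = C := d.fst.2
      rcases stack_adj.1 hd with ⟨x, y, h, hx, hy⟩ | ⟨x, y, h, hx, hy⟩
      · exact ⟨Sum.inl ⟨x, by rw [hx, hC]⟩, y, h, hx, hy⟩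
      · exact ⟨Sum.inr ⟨x, by rw [hx, hC]⟩, y, h, hx, hy⟩
    choose f hf using hR
    refine Fintype.card_le_of_injective f (fun d d' h => ?_)
    have e1 := hf d
    have e2 := hf d'
    rw [h] at e1
    generalize f d' = s at e1 e2
    have key : d.fst.1 = d'.fst.1 ∧ d.snd.1 = d'.snd.1 := by
      rcases s with x | x
      · obtain ⟨y, h1, h2, h3⟩ := e1
        obtain ⟨y', h1', h2', h3'⟩ := e2
        have := a.adj_unique h1 h1'
        subst this
        exact ⟨h2 ▸ h2', h3 ▸ h3'⟩
      · obtain ⟨y, h1, h2, h3⟩ := e1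
        obtain ⟨y', h1', h2', h3'⟩ := e2
        have := b.adj_unique h1 h1'
        subst this
        exact ⟨h2 ▸ h2', h3 ▸ h3'⟩
    exact SimpleGraph.Dart.ext _ _ (Prod.ext (Subtype.ext key.1) (Subtype.ext key.2))
  obtain ⟨f, hf⟩ : ∃ f : Fin m ⊕ (Fin n ⊕ Fin p) → ℕ, f = fun v => if mk v = C then 1 else 0 :=
    ⟨_, rfl⟩
  replace hU : Even (∑ v, f (upper v)) := by rw [hf]; convert hU
  replace hL : Even (∑ v, f (lower v)) := by rw [hf]; convert hL
  replace hV : Nat.card C = ∑ v, f v := by rw [hf]; convert hV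
  suffices h : Even (∑ v, f (outer v)) ∧ ∑ v, f (outer v) ≤ 2 by
    rw [hf] at h; convert h
  have h4 : Fintype.card {v : Fin m ⊕ Fin n // mk (upper v) = C} = ∑ v, f (upper v) := by
    rw [Fintype.card_subtype, Finset.card_filter, hf]
  have h5 : Fintype.card {v : Fin n ⊕ Fin p // mk (lower v) = C} = ∑ v, f (lower v) := by
    rw [Fintype.card_subtype, Finset.card_filter, hf]
  rw [hV, Nat.card_eq_fintype_card, ← SimpleGraph.edgeFinset_card] at h1
  rw [Fintype.card_sum, h4, h5, h2] at h3
  clear h4 h5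
  simp only [Fintype.sum_sum_type, upper, lower, outer, Function.Embedding.coeFn_mk, Sum.map_inl,
    Sum.map_inr, id_eq] at h1 h3 hU hL ⊢
  constructor
  · rw [Nat.even_iff] at *; omega
  · omega

/-- The concatenation of two diagrams, closed loops being discarded: two points of the outer rows
are joined when they are connected in the stack. -/
def comp (a : BrauerDiagram m n) (b : BrauerDiagram n p) : BrauerDiagram m p where
  graph :=
    { Adj := fun v w => v ≠ w ∧ (stack a b).Reachable (outer v) (outer w)
      symm := ⟨fun _ _ h => ⟨h.1.symm, h.2.symm⟩⟩
      loopless := ⟨fun _ h => h.1 rfl⟩ }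
  existsUnique_adj := by
    classical
    intro v
    obtain ⟨he, hl⟩ := card_outer a b ((stack a b).connectedComponentMk (outer v))
    rw [← Finset.card_filter] at he hl
    set s := Finset.univ.filter fun w : Fin m ⊕ Fin p =>
      (stack a b).connectedComponentMk (outer w) = (stack a b).connectedComponentMk (outer v)
      with hs
    have hmem : ∀ w, w ∈ s ↔ (stack a b).Reachable (outer v) (outer w) := by
      intro w
      simp only [hs, Finset.mem_filter, Finset.mem_univ, true_and,
        SimpleGraph.ConnectedComponent.eq]
      exact SimpleGraph.reachable_comm
    have hv : v ∈ s := (hmem v).2 (SimpleGraph.Reachable.refl _)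
    have h0 : 0 < s.card := Finset.card_pos.2 ⟨v, hv⟩
    have h2 : s.card = 2 := by rw [Nat.even_iff] at he; omega
    have h1 : (s.erase v).card = 1 := by rw [Finset.card_erase_of_mem hv, h2]
    obtain ⟨w, hw⟩ := Finset.card_eq_one.1 h1
    have hw' : ∀ u, (v ≠ u ∧ (stack a b).Reachable (outer v) (outer u)) ↔ u = w := by
      intro u
      rw [← hmem, ← Finset.mem_singleton, ← hw, Finset.mem_erase, ne_comm]
    exact ⟨w, (hw' w).2 rfl, fun u hu => (hw' u).1 hu⟩

/-- The diagram of a permutation: the `i`-th bottom point is joined to the `σ i`-th top point. -/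
def ofPerm (σ : Equiv.Perm (Fin n)) : BrauerDiagram n n where
  graph :=
    { Adj := fun v w => (∃ i, v = Sum.inl (σ i) ∧ w = Sum.inr i) ∨
        (∃ i, v = Sum.inr i ∧ w = Sum.inl (σ i))
      symm := ⟨by rintro _ _ (⟨i, rfl, rfl⟩ | ⟨i, rfl, rfl⟩) <;> simp⟩
      loopless := ⟨by rintro _ (⟨i, h, h'⟩ | ⟨i, h, h'⟩) <;> simp [h] at h'⟩ }
  existsUnique_adj := by
    rintro (i | i)
    · exact ⟨Sum.inr (σ.symm i), Or.inl ⟨_, by simp, rfl⟩, by rintro _ (⟨j, h, rfl⟩ | ⟨j, h, rfl⟩)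
        <;> simp_all⟩
    · exact ⟨Sum.inl (σ i), Or.inr ⟨_, rfl, rfl⟩, by rintro _ (⟨j, h, rfl⟩ | ⟨j, h, rfl⟩)
        <;> simp_all⟩

/-- Reflection of a diagram in a horizontal line. -/
def flip (d : BrauerDiagram m n) : BrauerDiagram n m where
  graph := d.graph.comap Sum.swap
  existsUnique_adj := by
    intro v
    obtain ⟨w, hw, hu⟩ := d.existsUnique_adj v.swap
    exact ⟨w.swap, by simpa using hw, fun u h => by rw [← hu _ h, Sum.swap_swap]⟩

/-- The number of through strings: of edges joining the top row to the bottom row. -/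
noncomputable def throughStrings (d : BrauerDiagram m n) : ℕ :=
  Nat.card {j : Fin n // ∃ i, d.graph.Adj (Sum.inl i) (Sum.inr j)}

/-! Associativity is checked on the two-colourings of the points. -/

open Classical in
/-- The matrix recording which two-colourings are constant on the edges of a diagram. -/
noncomputable def colorMatrix (d : BrauerDiagram m n) : Matrix (Fin m → Bool) (Fin n → Bool) ℕ :=
  fun x y => if ∀ v w, d.graph.Adj v w → Sum.elim x y v = Sum.elim x y w then 1 else 0

theorem colorMatrix_mul (a : BrauerDiagram m n) (b : BrauerDiagram n p) :
    colorMatrix a * colorMatrix b = 2 ^ loops a b • colorMatrix (comp a b) := by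
  classical
  ext x z
  set mk := (stack a b).connectedComponentMk with hmk
  have hL : (colorMatrix a * colorMatrix b) x z = Fintype.card {y : Fin n → Bool //
      ∀ u v, (stack a b).Adj u v →
        Sum.elim x (Sum.elim y z) u = Sum.elim x (Sum.elim y z) v} := by
    rw [Matrix.mul_apply, Fintype.card_subtype, Finset.card_filter]
    refine Finset.sum_congr rfl fun y _ => ?_
    rw [colorMatrix, colorMatrix, ite_zero_mul_ite_zero, mul_one]
    congr 1
    have e1 : ∀ v, Sum.elim x (Sum.elim y z) (upper v) = Sum.elim x y v := by
      rintro (v | v) <;> rfl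
    have e2 : ∀ v, Sum.elim x (Sum.elim y z) (lower v) = Sum.elim y z v := by
      rintro (v | v) <;> rfl
    simp only [stack_adj, eq_iff_iff]
    constructor
    · rintro ⟨h1, h2⟩ _ _ (⟨u, v, h, rfl, rfl⟩ | ⟨u, v, h, rfl, rfl⟩)
      · rw [e1, e1]; exact h1 _ _ h
      · rw [e2, e2]; exact h2 _ _ h
    · intro h
      refine ⟨fun u v huv => ?_, fun u v huv => ?_⟩
      · rw [← e1, ← e1]; exact h _ _ (Or.inl ⟨_, _, huv, rfl, rfl⟩)
      · rw [← e2, ← e2]; exact h _ _ (Or.inr ⟨_, _, huv, rfl, rfl⟩)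
  have hreach : ∀ y : Fin n → Bool, (∀ u v, (stack a b).Adj u v →
      Sum.elim x (Sum.elim y z) u = Sum.elim x (Sum.elim y z) v) →
      ∀ u v, (stack a b).Reachable u v →
        Sum.elim x (Sum.elim y z) u = Sum.elim x (Sum.elim y z) v := by
    rintro y h u v ⟨w⟩
    induction w with
    | nil => rfl
    | cons h1 _ ih => exact (h _ _ h1).trans ih
  have e3 : ∀ (y : Fin n → Bool) v,
      Sum.elim x (Sum.elim y z) (outer v) = Sum.elim x z v := by
    rintro y (v | v) <;> rfl
  rw [hL, Matrix.smul_apply, colorMatrix]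
  split_ifs with hc
  · have hc' : ∀ v w, (stack a b).Reachable (outer v) (outer w) →
        Sum.elim x z v = Sum.elim x z w := by
      intro v w h
      by_cases hvw : v = w
      · rw [hvw]
      · exact hc v w ⟨hvw, h⟩
    let T := {C : (stack a b).ConnectedComponent // ∀ v, mk (outer v) ≠ C}
    have hcol : ∀ C : (stack a b).ConnectedComponent, ∀ h : T → Bool, ∃ c : Bool,
        (∀ v, mk (outer v) = C → Sum.elim x z v = c) ∧
        ∀ hC : (∀ v, mk (outer v) ≠ C), c = h ⟨C, hC⟩ := by
      intro C h
      by_cases hC : ∀ v, mk (outer v) ≠ C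
      · exact ⟨h ⟨C, hC⟩, fun v hv => (hC v hv).elim, fun _ => rfl⟩
      · obtain ⟨v, hv⟩ := not_forall_not.1 hC
        refine ⟨Sum.elim x z v, fun w hw => hc' _ _ ?_, fun hC' => (hC hC').elim⟩
        exact SimpleGraph.ConnectedComponent.eq.1 (hw.trans hv.symm)
    choose c hc1 hc2 using hcol
    have hmid : ∀ C : T, ∃ i : Fin n, mk (Sum.inr (Sum.inl i)) = C.1 := by
      rintro ⟨C, hC⟩
      obtain ⟨v, rfl⟩ := C.exists_rep
      rcases v with v | v | v
      · exact (hC (Sum.inl v) rfl).elim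
      · exact ⟨v, rfl⟩
      · exact (hC (Sum.inr v) rfl).elim
    choose mid hmid using hmid
    have hel : ∀ (h : T → Bool) u, Sum.elim x (Sum.elim (fun i => c (mk (Sum.inr (Sum.inl i))) h) z)
        u = c (mk u) h := by
      rintro h (u | u | u)
      · exact hc1 _ h (Sum.inl u) rfl
      · rfl
      · exact hc1 _ h (Sum.inr u) rfl
    have : Fintype.card {y : Fin n → Bool // ∀ u v, (stack a b).Adj u v →
        Sum.elim x (Sum.elim y z) u = Sum.elim x (Sum.elim y z) v} =
        Fintype.card (T → Bool) := by
      refine Fintype.card_congr ⟨fun y C => y.1 (mid C), fun h =>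
        ⟨fun i => c (mk (Sum.inr (Sum.inl i))) h, fun u v huv => ?_⟩, fun y => ?_, fun h => ?_⟩
      · rw [hel, hel, show mk u = mk v from SimpleGraph.ConnectedComponent.eq.2 huv.reachable]
      · apply Subtype.ext
        funext i
        simp only
        by_cases hC : ∀ v, mk (outer v) ≠ mk (Sum.inr (Sum.inl i))
        · rw [hc2 _ _ hC]
          exact hreach y.1 y.2 (Sum.inr (Sum.inl (mid ⟨_, hC⟩))) (Sum.inr (Sum.inl i))
            (SimpleGraph.ConnectedComponent.eq.1 (hmid ⟨_, hC⟩))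
        · obtain ⟨v, hv⟩ := not_forall_not.1 hC
          rw [← hc1 _ _ v hv, ← e3 y.1]
          exact hreach y.1 y.2 _ (Sum.inr (Sum.inl i)) (SimpleGraph.ConnectedComponent.eq.1 hv)
      · funext C
        simp only
        rw [hmid, hc2 C.1 h C.2]
    rw [this, Fintype.card_fun, Fintype.card_bool, loops, Nat.card_eq_fintype_card]
    simp [T, hmk]
  · rw [smul_zero, Fintype.card_eq_zero_iff]
    refine ⟨fun y => hc fun v w h => ?_⟩
    rw [← e3 y.1, ← e3 y.1]
    exact hreach y.1 y.2 _ _ h.2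

theorem smul_colorMatrix_inj {a b : BrauerDiagram m n} {k l : ℕ}
    (h : 2 ^ k • colorMatrix a = 2 ^ l • colorMatrix b) : k = l ∧ a = b := by
  classical
  have hk : k = l := by
    have := congrFun (congrFun h fun _ => true) fun _ => true
    have e : ∀ (v : Fin m ⊕ Fin n), Sum.elim (fun _ => true) (fun _ => true) v = true := by
      rintro (_ | _) <;> rfl
    simp only [Matrix.smul_apply, colorMatrix, e] at this
    simpa using this
  refine ⟨hk, ?_⟩
  have h' : colorMatrix a = colorMatrix b := by
    subst hk
    ext x y
    simpa using congrFun (congrFun h x) y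
  have key : ∀ (d : BrauerDiagram m n) (v w : Fin m ⊕ Fin n), d.graph.Adj v w ↔ v ≠ w ∧
      colorMatrix d (fun i => decide (Sum.inl i = v ∨ Sum.inl i = w))
        (fun j => decide (Sum.inr j = v ∨ Sum.inr j = w)) = 1 := by
    intro d v w
    have e : ∀ u : Fin m ⊕ Fin n, Sum.elim (fun i => decide (Sum.inl i = v ∨ Sum.inl i = w))
        (fun j => decide (Sum.inr j = v ∨ Sum.inr j = w)) u = decide (u = v ∨ u = w) := by
      rintro (_ | _) <;> rfl
    simp only [colorMatrix, e, decide_eq_decide, ite_eq_left_iff, not_forall, zero_ne_one,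
      imp_false, not_exists, not_not]
    constructor
    · intro hvw
      refine ⟨hvw.ne, fun s t hst => ⟨?_, ?_⟩⟩
      · rintro (rfl | rfl)
        · exact Or.inr (d.adj_unique hst hvw)
        · exact Or.inl (d.adj_unique hst hvw.symm)
      · rintro (rfl | rfl)
        · exact Or.inr (d.adj_unique hst.symm hvw)
        · exact Or.inl (d.adj_unique hst.symm hvw.symm)
    · rintro ⟨hne, hh⟩
      obtain ⟨u, hu, -⟩ := d.existsUnique_adj v
      rcases (hh v u hu).1 (Or.inl rfl) with h1 | h1
      · exact (hu.ne h1.symm).elim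
      · exact h1 ▸ hu
  ext v w
  rw [key, key, h']

theorem comp_loops_eq_of_mul {a : BrauerDiagram m n} {b : BrauerDiagram n p}
    {c : BrauerDiagram m p} {k : ℕ}
    (h : colorMatrix a * colorMatrix b = 2 ^ k • colorMatrix c) :
    loops a b = k ∧ comp a b = c :=
  smul_colorMatrix_inj ((colorMatrix_mul a b).symm.trans h)

theorem comp_assoc_aux (a : BrauerDiagram m n) (b : BrauerDiagram n p) (c : BrauerDiagram p q) :
    loops a b + loops (comp a b) c = loops b c + loops a (comp b c) ∧
      comp (comp a b) c = comp a (comp b c) := by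
  apply smul_colorMatrix_inj
  have h := Matrix.mul_assoc (colorMatrix a) (colorMatrix b) (colorMatrix c)
  rw [colorMatrix_mul, colorMatrix_mul, Matrix.smul_mul, Matrix.mul_smul, colorMatrix_mul,
    colorMatrix_mul, smul_smul, smul_smul] at h
  rw [pow_add, pow_add, h]

theorem colorMatrix_flip (d : BrauerDiagram m n) : colorMatrix d.flip = (colorMatrix d).transpose := by
  ext y x
  simp only [colorMatrix, Matrix.transpose_apply, flip, SimpleGraph.comap_adj]
  congr 1
  rw [eq_iff_iff, (Equiv.sumComm (Fin n) (Fin m)).forall_congr_left]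
  refine forall_congr' fun v => ?_
  rw [(Equiv.sumComm (Fin n) (Fin m)).forall_congr_left]
  refine forall_congr' fun w => ?_
  rcases v with v | v <;> rcases w with w | w <;> rfl

theorem flip_flip (d : BrauerDiagram m n) : d.flip.flip = d := by
  ext v w
  simp [flip]

theorem flip_comp (a : BrauerDiagram m n) (b : BrauerDiagram n p) :
    loops b.flip a.flip = loops a b ∧ comp b.flip a.flip = (comp a b).flip := by
  apply comp_loops_eq_of_mul
  rw [colorMatrix_flip, colorMatrix_flip, ← Matrix.transpose_mul, colorMatrix_mul,
    colorMatrix_flip, Matrix.transpose_smul]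

theorem colorMatrix_ofPerm (σ : Equiv.Perm (Fin n)) (x y : Fin n → Bool) :
    colorMatrix (ofPerm σ) x y = if x ∘ σ = y then 1 else 0 := by
  classical
  rw [colorMatrix]
  congr 1
  rw [eq_iff_iff, funext_iff]
  constructor
  · intro h i
    exact h _ _ (Or.inl ⟨i, rfl, rfl⟩)
  · rintro h _ _ (⟨i, rfl, rfl⟩ | ⟨i, rfl, rfl⟩)
    · exact h i
    · exact (h i).symm

theorem ofPerm_flip (σ : Equiv.Perm (Fin n)) : (ofPerm σ).flip = ofPerm σ⁻¹ := by
  refine (smul_colorMatrix_inj (k := 0) (l := 0) ?_).2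
  ext x y
  rw [colorMatrix_flip, Matrix.smul_apply, Matrix.smul_apply, Matrix.transpose_apply,
    colorMatrix_ofPerm, colorMatrix_ofPerm]
  congr 2
  rw [eq_iff_iff]
  constructor
  · rintro rfl; ext i; simp
  · rintro rfl; ext i; simp

theorem ofPerm_comp_ofPerm (σ τ : Equiv.Perm (Fin n)) :
    loops (ofPerm σ) (ofPerm τ) = 0 ∧ comp (ofPerm σ) (ofPerm τ) = ofPerm (σ * τ) := by
  apply comp_loops_eq_of_mul
  ext x y
  simp only [Matrix.mul_apply, colorMatrix_ofPerm, Matrix.smul_apply, pow_zero, one_smul,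
    ite_mul, one_mul, zero_mul, Finset.sum_ite_eq, Finset.mem_univ, if_true]
  rfl

theorem one_comp (d : BrauerDiagram m n) : loops (ofPerm 1) d = 0 ∧ comp (ofPerm 1) d = d := by
  apply comp_loops_eq_of_mul
  ext x y
  rw [Matrix.mul_apply, Finset.sum_eq_single x, colorMatrix_ofPerm, if_pos (by simp), one_mul, pow_zero,
    one_smul]
  · intro z _ hz
    rw [colorMatrix_ofPerm, if_neg (fun h => hz h.symm), zero_mul]
  · exact fun h => (h (Finset.mem_univ _)).elim

theorem comp_one (d : BrauerDiagram m n) : loops d (ofPerm 1) = 0 ∧ comp d (ofPerm 1) = d := by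
  have h := flip_comp (ofPerm 1) d.flip
  rw [ofPerm_flip, flip_flip, inv_one] at h
  rw [h.1, h.2, (one_comp d.flip).1, (one_comp d.flip).2, flip_flip]
  exact ⟨rfl, rfl⟩

theorem ofPerm_comp_loops (σ : Equiv.Perm (Fin m)) (d : BrauerDiagram m n) :
    loops (ofPerm σ) d = 0 := by
  have h := (comp_assoc_aux (ofPerm σ⁻¹) (ofPerm σ) d).1
  rw [(ofPerm_comp_ofPerm _ _).1, (ofPerm_comp_ofPerm _ _).2, inv_mul_cancel,
    (one_comp d).1] at h
  omega

end BrauerDiagram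

/-- The `K`-linear combinations of Brauer diagrams with `m` points on the top row and `n` points on
the bottom row. The parameter `δ`, the value of a closed loop, enters in their composition. -/
def BrauerHom (K : Type*) [Field K] (_δ : K) (m n : ℕ) : Type _ := BrauerDiagram m n →₀ K

namespace BrauerHom

variable {K : Type*} [Field K] {δ : K} {m n p q : ℕ}

noncomputable instance : AddCommGroup (BrauerHom K δ m n) :=
  inferInstanceAs (AddCommGroup (BrauerDiagram m n →₀ K))

noncomputable instance : Module K (BrauerHom K δ m n) :=
  inferInstanceAs (Module K (BrauerDiagram m n →₀ K))

/-- A diagram, as a basis element. -/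
noncomputable def ofDiagram (d : BrauerDiagram m n) : BrauerHom K δ m n := Finsupp.single d (1 : K)

/-- The coefficient of a diagram. -/
noncomputable def coeff (d : BrauerDiagram m n) : BrauerHom K δ m n →ₗ[K] K :=
  Finsupp.lapply (R := K) (M := K) d

/-- Linear extension of a function on diagrams. -/
noncomputable def extend {V : Type*} [AddCommGroup V] [Module K V] (f : BrauerDiagram m n → V) :
    BrauerHom K δ m n →ₗ[K] V :=
  Finsupp.linearCombination K f

theorem extend_ofDiagram {V : Type*} [AddCommGroup V] [Module K V] (f : BrauerDiagram m n → V)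
    (d : BrauerDiagram m n) : extend f (ofDiagram (δ := δ) d) = f d :=
  (Finsupp.linearCombination_single K (1 : K) d).trans (one_smul K _)

theorem hom_ext {V : Type*} [AddCommGroup V] [Module K V] {f g : BrauerHom K δ m n →ₗ[K] V}
    (h : ∀ d, f (ofDiagram d) = g (ofDiagram d)) : f = g :=
  Finsupp.lhom_ext' fun d => LinearMap.ext_ring (h d)

open Classical in
theorem coeff_ofDiagram (d e : BrauerDiagram m n) :
    coeff d (ofDiagram (δ := δ) e) = if e = d then 1 else 0 :=
  Finsupp.single_apply

/-- Composition, the bilinear extension of concatenation of diagrams: every closed loop that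
arises is replaced by a factor `δ`. -/
noncomputable def comp :
    BrauerHom K δ m n →ₗ[K] BrauerHom K δ n p →ₗ[K] BrauerHom K δ m p :=
  extend fun a => extend fun b => δ ^ a.loops b • ofDiagram (a.comp b)

/-- Reflection in a horizontal line, extended linearly. -/
noncomputable def flip : BrauerHom K δ m n →ₗ[K] BrauerHom K δ n m :=
  extend fun d => ofDiagram d.flip

theorem comp_ofDiagram (a : BrauerDiagram m n) (b : BrauerDiagram n p) :
    comp (ofDiagram (δ := δ) a) (ofDiagram b) = δ ^ a.loops b • ofDiagram (a.comp b) := by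
  rw [comp, extend_ofDiagram, extend_ofDiagram]

theorem flip_ofDiagram (a : BrauerDiagram m n) :
    flip (ofDiagram (δ := δ) a) = ofDiagram a.flip := extend_ofDiagram _ _

theorem comp_assoc (x : BrauerHom K δ m n) (y : BrauerHom K δ n p) (z : BrauerHom K δ p q) :
    comp (comp x y) z = comp x (comp y z) := by
  have h : (comp (K := K) (δ := δ) (m := m) (n := n) (p := p)).compr₂
      (comp (K := K) (δ := δ) (m := m) (n := p) (p := q)) =
      ((LinearMap.llcomp K _ _ _).flip (comp (K := K) (δ := δ) (m := n) (n := p) (p := q))) ∘ₗ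
        (LinearMap.llcomp K _ _ _ ∘ₗ comp (K := K) (δ := δ) (m := m) (n := n) (p := q)) := by
    refine hom_ext fun a => hom_ext fun b => hom_ext fun c => ?_
    simp only [LinearMap.compr₂_apply, LinearMap.comp_apply, LinearMap.flip_apply,
      LinearMap.llcomp_apply, comp_ofDiagram, map_smul, LinearMap.smul_apply, smul_smul, ← pow_add]
    rw [(BrauerDiagram.comp_assoc_aux a b c).1, (BrauerDiagram.comp_assoc_aux a b c).2, add_comm]
  exact congrArg (fun f => f x y z) h

theorem flip_flip (x : BrauerHom K δ m n) : flip (flip x) = x := by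
  have h : flip ∘ₗ flip = (LinearMap.id : BrauerHom K δ m n →ₗ[K] _) :=
    hom_ext fun a => by simp [flip_ofDiagram, BrauerDiagram.flip_flip]
  exact congrArg (fun f => f x) h

theorem flip_comp (x : BrauerHom K δ m n) (y : BrauerHom K δ n p) :
    flip (comp x y) = comp (flip y) (flip x) := by
  have h : (comp (K := K) (δ := δ) (m := m) (n := n) (p := p)).compr₂ flip =
      ((comp (K := K) (δ := δ)).flip.compl₂ flip) ∘ₗ flip := by
    refine hom_ext fun a => hom_ext fun b => ?_
    simp only [LinearMap.compr₂_apply, LinearMap.comp_apply, LinearMap.flip_apply,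
      LinearMap.compl₂_apply, comp_ofDiagram, map_smul, flip_ofDiagram]
    rw [(BrauerDiagram.flip_comp a b).1, (BrauerDiagram.flip_comp a b).2]
  exact congrArg (fun f => f x y) h

theorem one_comp (x : BrauerHom K δ m n) :
    comp (ofDiagram (BrauerDiagram.ofPerm 1)) x = x := by
  have h : comp (ofDiagram (BrauerDiagram.ofPerm 1)) =
      (LinearMap.id : BrauerHom K δ m n →ₗ[K] _) := by
    refine hom_ext fun a => ?_
    rw [comp_ofDiagram, (BrauerDiagram.one_comp a).1, (BrauerDiagram.one_comp a).2, pow_zero,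
      one_smul, LinearMap.id_apply]
  exact congrArg (fun f => f x) h

theorem comp_one (x : BrauerHom K δ m n) :
    comp x (ofDiagram (BrauerDiagram.ofPerm 1)) = x := by
  have h := congrArg flip (one_comp (flip x))
  rwa [flip_comp, flip_flip, flip_ofDiagram, BrauerDiagram.ofPerm_flip, inv_one] at h

/-- The part of a combination of diagrams on `n + n` points that is supported on the diagrams with
`n` through strings, acting through a representation of the symmetric group. -/
noncomputable def permPart {V : Type*} [AddCommGroup V] [Module K V]
    (ρ : Representation K (Equiv.Perm (Fin n)) V) : BrauerHom K δ n n →ₗ[K] Module.End K V :=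
  ∑ σ : Equiv.Perm (Fin n), (coeff (BrauerDiagram.ofPerm σ)).smulRight (ρ σ)

section permPart

variable {V : Type*} [AddCommGroup V] [Module K V] (ρ : Representation K (Equiv.Perm (Fin n)) V)

theorem permPart_apply (x : BrauerHom K δ n n) :
    permPart ρ x = ∑ σ : Equiv.Perm (Fin n), coeff (BrauerDiagram.ofPerm σ) x • ρ σ := by
  simp [permPart, LinearMap.sum_apply]

theorem coeff_flip (d : BrauerDiagram m n) (x : BrauerHom K δ n m) :
    coeff d (flip x) = coeff d.flip x := by
  have h : coeff d ∘ₗ flip = (coeff d.flip : BrauerHom K δ n m →ₗ[K] K) := by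
    refine hom_ext fun a => ?_
    rw [LinearMap.comp_apply, flip_ofDiagram, coeff_ofDiagram, coeff_ofDiagram]
    congr 1
    rw [eq_iff_iff]
    constructor
    · rintro rfl; rw [BrauerDiagram.flip_flip]
    · rintro rfl; rw [BrauerDiagram.flip_flip]
  exact congrArg (fun f => f x) h

theorem permPart_flip (x : BrauerHom K δ n n) :
    permPart ρ (flip x) = ∑ σ : Equiv.Perm (Fin n), coeff (BrauerDiagram.ofPerm σ) x • ρ σ⁻¹ := by
  rw [permPart_apply, ← Equiv.sum_comp (Equiv.inv (Equiv.Perm (Fin n)))]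
  refine Finset.sum_congr rfl fun σ _ => ?_
  rw [coeff_flip, BrauerDiagram.ofPerm_flip, Equiv.inv_apply, inv_inv]

theorem coeff_ofPerm_comp (τ : Equiv.Perm (Fin n)) (d : BrauerDiagram n m)
    (x : BrauerHom K δ n m) :
    coeff ((BrauerDiagram.ofPerm τ).comp d) (comp (ofDiagram (BrauerDiagram.ofPerm τ)) x) =
      coeff d x := by
  have h : coeff ((BrauerDiagram.ofPerm τ).comp d) ∘ₗ
      comp (ofDiagram (BrauerDiagram.ofPerm τ)) = (coeff d : BrauerHom K δ n m →ₗ[K] K) := by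
    refine hom_ext fun a => ?_
    rw [LinearMap.comp_apply, comp_ofDiagram, BrauerDiagram.ofPerm_comp_loops, pow_zero, one_smul,
      coeff_ofDiagram, coeff_ofDiagram]
    congr 1
    rw [eq_iff_iff]
    refine ⟨fun h => ?_, fun h => h ▸ rfl⟩
    have h' := congrArg (BrauerDiagram.comp (BrauerDiagram.ofPerm τ⁻¹)) h
    rwa [← (BrauerDiagram.comp_assoc_aux _ _ _).2, ← (BrauerDiagram.comp_assoc_aux _ _ _).2,
      (BrauerDiagram.ofPerm_comp_ofPerm _ _).2, inv_mul_cancel, (BrauerDiagram.one_comp _).2,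
      (BrauerDiagram.one_comp _).2] at h'
  exact congrArg (fun f => f x) h

theorem permPart_ofPerm_comp (τ : Equiv.Perm (Fin n)) (x : BrauerHom K δ n n) :
    permPart ρ (comp (ofDiagram (BrauerDiagram.ofPerm τ)) x) = ρ τ * permPart ρ x := by
  rw [permPart_apply, permPart_apply, ← Equiv.sum_comp (Equiv.mulLeft τ), Finset.mul_sum]
  refine Finset.sum_congr rfl fun σ _ => ?_
  rw [Equiv.coe_mulLeft, ← (BrauerDiagram.ofPerm_comp_ofPerm τ σ).2, coeff_ofPerm_comp, map_mul,
    mul_smul_comm]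

theorem permPart_flip_comp_eq_zero (d : BrauerDiagram m n) (hd : d.throughStrings < n)
    (x : BrauerHom K δ m n) : permPart ρ (comp (flip (ofDiagram d)) x) = 0 := by
  have h : permPart ρ ∘ₗ comp (flip (ofDiagram d)) =
      (0 : BrauerHom K δ m n →ₗ[K] Module.End K V) := by
    refine hom_ext fun e => ?_
    rw [LinearMap.comp_apply, flip_ofDiagram, comp_ofDiagram, map_smul, permPart_apply,
      Finset.sum_eq_zero, smul_zero, LinearMap.zero_apply]
    intro σ _
    rw [coeff_ofDiagram, if_neg, zero_smul]
    intro hσ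
    obtain ⟨j, hj⟩ : ∃ j : Fin n, ¬ ∃ i, d.graph.Adj (Sum.inl i) (Sum.inr j) := by
      by_contra! hall
      have : d.throughStrings = n := by
        rw [BrauerDiagram.throughStrings, Nat.card_congr (Equiv.subtypeUnivEquiv hall),
          Nat.card_fin]
      omega
    obtain ⟨w, hw, -⟩ := d.existsUnique_adj (Sum.inr j)
    rcases w with i | j'
    · exact hj ⟨i, hw.symm⟩
    · have hadj : (d.flip.comp e).graph.Adj (Sum.inl j) (Sum.inl j') := by
        refine ⟨fun h => hw.ne (congrArg Sum.inr (Sum.inl_injective h)), ?_⟩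
        exact (BrauerDiagram.stack_adj.2 (Or.inl ⟨Sum.inl j, Sum.inl j', hw, rfl, rfl⟩)).reachable
      rw [hσ] at hadj
      rcases hadj with ⟨i, -, h⟩ | ⟨i, h, -⟩ <;> simp at h
  exact congrArg (fun f => f x) h

end permPart

end BrauerHom

/-- The Brauer algebra `B_r(δ)` over the field `K`: it has the Brauer diagrams on `r + r` points as
a basis, and diagrams are multiplied by concatenation, with a factor `δ` for every closed loop. -/
def BrauerAlgebra (K : Type*) [Field K] (δ : K) (r : ℕ) : Type _ := BrauerHom K δ r r

namespace BrauerAlgebra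

variable {K : Type*} [Field K] {δ : K} {r t : ℕ}

noncomputable instance : AddCommGroup (BrauerAlgebra K δ r) :=
  inferInstanceAs (AddCommGroup (BrauerHom K δ r r))

noncomputable instance : Module K (BrauerAlgebra K δ r) :=
  inferInstanceAs (Module K (BrauerHom K δ r r))

/-- An element of the Brauer algebra as a combination of diagrams. -/
noncomputable def toHom : BrauerAlgebra K δ r ≃ₗ[K] BrauerHom K δ r r :=
  LinearEquiv.refl K (BrauerHom K δ r r)

noncomputable instance : Ring (BrauerAlgebra K δ r) where
  mul x y := toHom.symm (BrauerHom.comp (toHom x) (toHom y))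
  one := toHom.symm (BrauerHom.ofDiagram (BrauerDiagram.ofPerm 1))
  left_distrib x y z := map_add (BrauerHom.comp (toHom x)) (toHom y) (toHom z)
  right_distrib x y z := LinearMap.map_add₂ BrauerHom.comp (toHom x) (toHom y) (toHom z)
  zero_mul x := LinearMap.map_zero₂ BrauerHom.comp (toHom x)
  mul_zero x := map_zero (BrauerHom.comp (toHom x))
  mul_assoc x y z := BrauerHom.comp_assoc (toHom x) (toHom y) (toHom z)
  one_mul x := BrauerHom.one_comp (toHom x)
  mul_one x := BrauerHom.comp_one (toHom x)
  neg_add_cancel := neg_add_cancel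
  sub_eq_add_neg := sub_eq_add_neg
  zsmul := fun z x => z • x
  zsmul_zero' := SubNegMonoid.zsmul_zero'
  zsmul_succ' := SubNegMonoid.zsmul_succ'
  zsmul_neg' := SubNegMonoid.zsmul_neg'
  nsmul := fun z x => z • x
  nsmul_zero := AddMonoid.nsmul_zero
  nsmul_succ := AddMonoid.nsmul_succ

noncomputable instance : Algebra K (BrauerAlgebra K δ r) :=
  Algebra.ofModule (fun c x y => LinearMap.map_smul₂ BrauerHom.comp c (toHom x) (toHom y))
    (fun c x y => map_smul (BrauerHom.comp (toHom x)) c (toHom y))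

/-- The Brauer algebra acts on combinations of diagrams with top row of size `r` from the left. -/
noncomputable instance : Module (BrauerAlgebra K δ r) (BrauerHom K δ r t) where
  smul b x := BrauerHom.comp (toHom b) x
  one_smul x := BrauerHom.one_comp x
  mul_smul a b x := BrauerHom.comp_assoc (toHom a) (toHom b) x
  smul_zero b := map_zero (BrauerHom.comp (toHom b))
  smul_add b := map_add (BrauerHom.comp (toHom b))
  add_smul a b x := LinearMap.map_add₂ BrauerHom.comp (toHom a) (toHom b) x
  zero_smul x := LinearMap.map_zero₂ BrauerHom.comp x

theorem smul_def (b : BrauerAlgebra K δ r) (x : BrauerHom K δ r t) :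
    b • x = BrauerHom.comp (toHom b) x := rfl

instance : IsScalarTower K (BrauerAlgebra K δ r) (BrauerHom K δ r t) where
  smul_assoc c b x := LinearMap.map_smul₂ BrauerHom.comp c (toHom b) x

instance : SMulCommClass K (BrauerAlgebra K δ r) (BrauerHom K δ r t) where
  smul_comm c b x := (map_smul (BrauerHom.comp (toHom b)) c x).symm

instance : SMulCommClass (BrauerAlgebra K δ r) K (BrauerHom K δ r t) := SMulCommClass.symm _ _ _

/-- The anti-automorphism reflecting diagrams in a horizontal line. -/
noncomputable def star (b : BrauerAlgebra K δ r) : BrauerAlgebra K δ r :=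
  toHom.symm (BrauerHom.flip (toHom b))

end BrauerAlgebra

/-! ### Specht modules -/

section Specht

variable (K : Type*) [Field K]

/-- The permutation module on functions `f : Fin t → ℕ`. Such a function stands for the tabloid that
has the entry `i` in row `f i`, and `σ` replaces every entry `i` by `σ i`. -/
noncomputable def tabloidRep (t : ℕ) :
    Representation K (Equiv.Perm (Fin t)) ((Fin t → ℕ) →₀ K) where
  toFun σ := Finsupp.lmapDomain K K fun f => f ∘ σ.symm
  map_one' := Finsupp.lmapDomain_id K K
  map_mul' σ τ := Finsupp.lmapDomain_comp K K (fun f => f ∘ τ.symm) (fun f => f ∘ σ.symm)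

/-- The polytabloid of a tableau `T` of shape `ν`, which has its entry `i` in the cell `T i`: the
sum of `sign σ • σ {T}` over the permutations `σ` preserving the columns of `T`. -/
noncomputable def polytabloid {ν : YoungDiagram} (T : Fin ν.card ≃ ν.cells) :
    (Fin ν.card → ℕ) →₀ K :=
  ∑ σ : Equiv.Perm (Fin ν.card) with ∀ i, (T (σ i)).1.2 = (T i).1.2,
    ((Equiv.Perm.sign σ : ℤ) : K) • tabloidRep K ν.card σ (Finsupp.single (fun i => (T i).1.1) 1)

/-- The Specht module `S(ν)`, spanned by the polytabloids of the tableaux of shape `ν`. -/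
noncomputable def specht (ν : YoungDiagram) : Submodule K ((Fin ν.card → ℕ) →₀ K) :=
  Submodule.span K (Set.range (polytabloid K (ν := ν)))

theorem tabloidRep_single (t : ℕ) (σ : Equiv.Perm (Fin t)) (f : Fin t → ℕ) (c : K) :
    tabloidRep K t σ (Finsupp.single f c) = Finsupp.single (f ∘ σ.symm) c :=
  Finsupp.mapDomain_single

theorem tabloidRep_polytabloid {ν : YoungDiagram} (T : Fin ν.card ≃ ν.cells)
    (τ : Equiv.Perm (Fin ν.card)) :
    tabloidRep K ν.card τ (polytabloid K T) = polytabloid K (τ.symm.trans T) := by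
  rw [polytabloid, polytabloid, map_sum]
  refine Finset.sum_equiv (MulAut.conj τ).toEquiv (fun σ => ?_) (fun σ _ => ?_)
  · simp only [Finset.mem_filter, Finset.mem_univ, true_and]
    constructor
    · intro h i
      simpa using h (τ.symm i)
    · intro h i
      simpa using h (τ i)
  · rw [map_smul]
    congr 1
    · have : Equiv.Perm.sign (MulAut.conj τ σ) = Equiv.Perm.sign σ := by
        rw [MulAut.conj_apply, map_mul, map_mul, mul_right_comm, ← map_mul, mul_inv_cancel,
          map_one, one_mul]
      exact congrArg (fun z : ℤˣ => ((z : ℤ) : K)) this.symm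
    · simp only [tabloidRep_single]
      congr 1
      funext i
      simp [Equiv.Perm.mul_def, Equiv.Perm.inv_def]

theorem tabloidRep_mem_specht {ν : YoungDiagram} (τ : Equiv.Perm (Fin ν.card))
    {s : (Fin ν.card → ℕ) →₀ K} (hs : s ∈ specht K ν) : tabloidRep K ν.card τ s ∈ specht K ν := by
  have : specht K ν ≤ (specht K ν).comap (tabloidRep K ν.card τ) := by
    refine Submodule.span_le.2 ?_
    rintro _ ⟨T, rfl⟩
    rw [SetLike.mem_coe, Submodule.mem_comap, tabloidRep_polytabloid]
    exact Submodule.subset_span ⟨_, rfl⟩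
  exact this hs

/-- The action of the symmetric group on the Specht module. -/
noncomputable def spechtRep (ν : YoungDiagram) :
    Representation K (Equiv.Perm (Fin ν.card)) (specht K ν) where
  toFun σ := (tabloidRep K ν.card σ).restrict fun _ hs => tabloidRep_mem_specht K σ hs
  map_one' := by ext1 s; apply Subtype.ext; simp
  map_mul' σ τ := by ext1 s; apply Subtype.ext; simp

/-- The symmetric bilinear form for which the tabloids are orthonormal. -/
noncomputable def tabloidForm (t : ℕ) : LinearMap.BilinForm K ((Fin t → ℕ) →₀ K) :=
  Finsupp.linearCombination K fun f => Finsupp.lapply f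

theorem tabloidForm_single (t : ℕ) (f g : Fin t → ℕ) :
    tabloidForm K t (Finsupp.single f 1) (Finsupp.single g 1) = if g = f then 1 else 0 := by
  classical
  simp [tabloidForm, Finsupp.single_apply]

theorem tabloidForm_symm (t : ℕ) (x y : (Fin t → ℕ) →₀ K) :
    tabloidForm K t x y = tabloidForm K t y x := by
  have h : tabloidForm K t = LinearMap.flip (tabloidForm K t) := by
    ext f g
    simp [tabloidForm_single, eq_comm]
  exact congrArg (fun f => f x y) h

theorem tabloidForm_rep (t : ℕ) (σ : Equiv.Perm (Fin t)) (x y : (Fin t → ℕ) →₀ K) :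
    tabloidForm K t x (tabloidRep K t σ y) = tabloidForm K t (tabloidRep K t σ⁻¹ x) y := by
  have h : (tabloidForm K t).compl₂ (tabloidRep K t σ) =
      (tabloidForm K t) ∘ₗ (tabloidRep K t σ⁻¹) := by
    ext f g
    simp only [LinearMap.coe_comp, Function.comp_apply, Finsupp.lsingle_apply,
      LinearMap.compl₂_apply, tabloidRep_single, tabloidForm_single]
    congr 1
    rw [eq_iff_iff]
    constructor
    · rintro rfl; ext i; simp [Equiv.Perm.inv_def]
    · rintro rfl; ext i; simp [Equiv.Perm.inv_def]
  exact congrArg (fun f => f x y) h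

/-- The restriction of this form to the Specht module. -/
noncomputable def spechtForm (ν : YoungDiagram) : LinearMap.BilinForm K (specht K ν) :=
  (tabloidForm K ν.card).restrict (specht K ν)

theorem spechtForm_symm (ν : YoungDiagram) (x y : specht K ν) :
    spechtForm K ν x y = spechtForm K ν y x := tabloidForm_symm K _ _ _

theorem spechtForm_rep (ν : YoungDiagram) (σ : Equiv.Perm (Fin ν.card)) (x y : specht K ν) :
    spechtForm K ν x (spechtRep K ν σ y) = spechtForm K ν (spechtRep K ν σ⁻¹ x) y :=
  tabloidForm_rep K _ σ _ _

end Specht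

/-! ### Cell modules -/

section CellModule

open scoped TensorProduct

variable (K : Type*) [Field K] (δ : K) (r : ℕ) (ν : YoungDiagram)

/-- The relations defining the cell module as a quotient of `BrauerHom K δ r t ⊗ S(ν)`, where `ν` is
a partition of `t`: diagrams with fewer than `t` through strings vanish, and the tensor product is
balanced over the group algebra of the symmetric group on `t` letters. -/
noncomputable def cellRelations :
    Submodule (BrauerAlgebra K δ r) (BrauerHom K δ r ν.card ⊗[K] specht K ν) :=
  Submodule.span (BrauerAlgebra K δ r)
    ({z | ∃ (d : BrauerDiagram r ν.card) (s : specht K ν), d.throughStrings < ν.card ∧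
        z = BrauerHom.ofDiagram d ⊗ₜ[K] s} ∪
      {z | ∃ (x : BrauerHom K δ r ν.card) (σ : Equiv.Perm (Fin ν.card)) (s : specht K ν),
        z = BrauerHom.comp x (BrauerHom.ofDiagram (BrauerDiagram.ofPerm σ)) ⊗ₜ[K] s -
          x ⊗ₜ[K] spechtRep K ν σ s})

/-- The cell module `W_r(ν) = I_r^t ⊗ S(ν)`, the tensor product being over the group algebra of the
symmetric group on `t = |ν|` letters. Here `I_r^t` is the space of combinations of diagrams with
top row of size `r` and bottom row of size `t`, modulo the diagrams with fewer than `t` through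
strings. (Adding `(r - t) / 2` horizontal edges at the right end of the bottom row identifies these
diagrams with a basis of the left ideal `B_r e_{t+1} e_{t+3} ⋯ e_{r-1}`.) -/
abbrev CellModule : Type _ := (BrauerHom K δ r ν.card ⊗[K] specht K ν) ⧸ cellRelations K δ r ν

/-- The form `(x ⊗ s, y ⊗ u) ↦ (s, (x^* y) u)` before passage to the quotient; `x^* y` acts on the
Specht module modulo diagrams with fewer than `t` through strings. -/
noncomputable def preCellForm :
    LinearMap.BilinForm K (BrauerHom K δ r ν.card ⊗[K] specht K ν) :=
  TensorProduct.lift (LinearMap.mk₂ K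
    (fun x s => TensorProduct.lift (LinearMap.mk₂ K
      (fun y u => spechtForm K ν s
        (BrauerHom.permPart (spechtRep K ν) (BrauerHom.comp (BrauerHom.flip x) y) u))
      (by intros; simp) (by intros; simp) (by intros; simp) (by intros; simp)))
    (by intros; ext; simp) (by intros; ext; simp) (by intros; ext; simp) (by intros; ext; simp))

theorem preCellForm_tmul (x y : BrauerHom K δ r ν.card) (s u : specht K ν) :
    preCellForm K δ r ν (x ⊗ₜ s) (y ⊗ₜ u) = spechtForm K ν s
      (BrauerHom.permPart (spechtRep K ν) (BrauerHom.comp (BrauerHom.flip x) y) u) := by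
  simp [preCellForm]

variable {K δ r ν}

theorem preCellForm_symm (z w : BrauerHom K δ r ν.card ⊗[K] specht K ν) :
    preCellForm K δ r ν z w = preCellForm K δ r ν w z := by
  have h : preCellForm K δ r ν = LinearMap.flip (preCellForm K δ r ν) := by
    refine TensorProduct.ext' fun x s => TensorProduct.ext' fun y u => ?_
    rw [LinearMap.flip_apply, preCellForm_tmul, preCellForm_tmul, spechtForm_symm]
    have e : BrauerHom.comp (BrauerHom.flip y) x =
        BrauerHom.flip (BrauerHom.comp (BrauerHom.flip x) y) := by
      rw [BrauerHom.flip_comp, BrauerHom.flip_flip]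
    rw [e, BrauerHom.permPart_flip, BrauerHom.permPart_apply, LinearMap.sum_apply,
      LinearMap.sum_apply, map_sum, map_sum, LinearMap.sum_apply]
    refine Finset.sum_congr rfl fun σ _ => ?_
    rw [LinearMap.smul_apply, LinearMap.smul_apply, map_smul, map_smul, LinearMap.smul_apply,
      spechtForm_symm, spechtForm_rep, spechtForm_symm]
  exact congrArg (fun f => f z w) h

theorem preCellForm_smul (b : BrauerAlgebra K δ r)
    (z w : BrauerHom K δ r ν.card ⊗[K] specht K ν) :
    preCellForm K δ r ν (b • z) w = preCellForm K δ r ν z (b.star • w) := by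
  induction z using TensorProduct.induction_on with
  | zero => simp
  | add z₁ z₂ h₁ h₂ => rw [smul_add, map_add, map_add, LinearMap.add_apply, h₁, h₂,
      LinearMap.add_apply]
  | tmul x s =>
    induction w using TensorProduct.induction_on with
    | zero => simp
    | add w₁ w₂ h₁ h₂ => rw [smul_add, map_add, map_add, h₁, h₂]
    | tmul y u =>
      rw [TensorProduct.smul_tmul', TensorProduct.smul_tmul', preCellForm_tmul, preCellForm_tmul,
        BrauerAlgebra.smul_def, BrauerAlgebra.smul_def, BrauerHom.flip_comp, BrauerHom.comp_assoc]
      rfl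

theorem preCellForm_relations {z : BrauerHom K δ r ν.card ⊗[K] specht K ν}
    (hz : z ∈ cellRelations K δ r ν) (w : BrauerHom K δ r ν.card ⊗[K] specht K ν) :
    preCellForm K δ r ν z w = 0 := by
  induction hz using Submodule.span_induction generalizing w with
  | zero => simp
  | add z₁ z₂ _ _ h₁ h₂ => rw [map_add, LinearMap.add_apply, h₁, h₂, add_zero]
  | smul b z _ h => rw [preCellForm_smul, h]
  | mem z hz =>
    induction w using TensorProduct.induction_on with
    | zero => simp
    | add w₁ w₂ h₁ h₂ => rw [map_add, h₁, h₂, add_zero]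
    | tmul y u =>
      rcases hz with ⟨d, s, hd, rfl⟩ | ⟨x, σ, s, rfl⟩
      · rw [preCellForm_tmul, BrauerHom.permPart_flip_comp_eq_zero _ _ hd, LinearMap.zero_apply,
          map_zero]
      · rw [map_sub, LinearMap.sub_apply, preCellForm_tmul, preCellForm_tmul,
          BrauerHom.flip_comp, BrauerHom.flip_ofDiagram, BrauerDiagram.ofPerm_flip,
          BrauerHom.comp_assoc, BrauerHom.permPart_ofPerm_comp, Module.End.mul_apply,
          spechtForm_rep, inv_inv, sub_self]

variable (K δ r ν)

/-- The canonical symmetric bilinear form on the cell module. -/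
noncomputable def cellForm : LinearMap.BilinForm K (CellModule K δ r ν) :=
  let q := Submodule.Quotient.restrictScalarsEquiv K (cellRelations K δ r ν)
  let f := ((cellRelations K δ r ν).restrictScalars K).liftQ (LinearMap.flip
    (((cellRelations K δ r ν).restrictScalars K).liftQ (preCellForm K δ r ν)
      fun _ hz => LinearMap.ext fun w => preCellForm_relations hz w))
    fun z hz => LinearMap.ext fun w => by
      obtain ⟨w, rfl⟩ := Submodule.Quotient.mk_surjective _ w
      exact (preCellForm_symm w z).trans (preCellForm_relations hz w)
  f.compl₁₂ q.symm.toLinearMap q.symm.toLinearMap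

theorem cellForm_mk (z w : BrauerHom K δ r ν.card ⊗[K] specht K ν) :
    cellForm K δ r ν (Submodule.Quotient.mk z) (Submodule.Quotient.mk w) =
      preCellForm K δ r ν z w :=
  preCellForm_symm w z

theorem cellForm_smul (b : BrauerAlgebra K δ r) (z w : CellModule K δ r ν) :
    cellForm K δ r ν (b • z) w = cellForm K δ r ν z (b.star • w) := by
  obtain ⟨z, rfl⟩ := Submodule.Quotient.mk_surjective _ z
  obtain ⟨w, rfl⟩ := Submodule.Quotient.mk_surjective _ w
  rw [← Submodule.Quotient.mk_smul, ← Submodule.Quotient.mk_smul, cellForm_mk, cellForm_mk,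
    preCellForm_smul]

/-- The radical of the canonical form on the cell module. -/
noncomputable def cellRadical : Submodule (BrauerAlgebra K δ r) (CellModule K δ r ν) where
  carrier := {z | ∀ w, cellForm K δ r ν z w = 0}
  zero_mem' := fun w => by rw [map_zero, LinearMap.zero_apply]
  add_mem' := fun hz hz' w => by rw [map_add, LinearMap.add_apply, hz w, hz' w, add_zero]
  smul_mem' := fun b z hz w => by rw [cellForm_smul]; exact hz _

/-- The module `L_r(ν)`, the quotient of the cell module by the radical of its form. -/
abbrev CellHead : Type _ := CellModule K δ r ν ⧸ cellRadical K δ r ν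

end CellModule

/-- The `R`-module `L` is a composition factor of the `R`-module `M`: it is isomorphic to one of the
successive quotients in a composition series from `0` to `M`. -/
def IsCompositionFactor (R L M : Type*) [Ring R] [AddCommGroup L] [Module R L] [AddCommGroup M]
    [Module R M] : Prop :=
  ∃ s : CompositionSeries (Submodule R M), s.head = ⊥ ∧ s.last = ⊤ ∧ ∃ i : Fin s.length,
    Nonempty ((s i.succ ⧸ (s i.castSucc).comap (s i.succ).subtype) ≃ₗ[R] L)

/-- The set `Λ_r` of partitions `ν` with `|ν| ≤ r` and `|ν| ≡ r` modulo `2`. -/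
def cellIndex (r : ℕ) : Set YoungDiagram := {ν | ν.card ≤ r ∧ ν.card ≡ r [MOD 2]}

/-!
Let `u` be the diagram with `r + 2` top and `r` bottom points that joins the last two top points and
is otherwise vertical. Since `u^* u = δ` and `δ ≠ 0`, the element `e = δ⁻¹ u u^*` of `B_{r+2}` is
idempotent, and `b ↦ δ⁻¹ u b u^*` identifies `B_r` with `e B_{r+2} e`
(`BrauerAlgebra.cornerMap`). Composition with `u` identifies `W_r(ν)` with `e W_{r+2}(ν)` and, as the
canonical forms are contravariant, `L_r(ν)` with `e L_{r+2}(ν)` (`isCornerModule_cellMap`,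
`isCornerModule_headMap`).

If `|ν| < r + 2`, every diagram with `r + 2` top and `|ν|` bottom points has an arc in its top row,
hence factors through `u`. So `W_{r+2}(ν)` is generated by its corner (`span_range_cellMap_cup`), and
by contravariance of the form `L_{r+2}(ν)` has no nonzero submodule with zero corner
(`eq_zero_of_cornerMap_one_smul`). These two properties of `L = L_{r+2}(μ)` imply that `L` is simple
if and only if `e L` is, and that `L` is a subquotient of a module `M` if `e L` is one of `e M`; the
converse of the latter is exactness of `M ↦ e M`. Since a composition factor of a module of finite
length is the same as a simple subquotient (`isCompositionFactor_iff`), the theorem follows. The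
argument does not need the simplicity of the modules `L_r(μ)`: it is part of being a composition
factor.
-/

/-! ### Composition factors as simple subquotients -/

theorem exists_compositionSeries_of_le {X : Type*} [Lattice X] [IsModularLattice X]
    [WellFoundedLT X] [WellFoundedGT X] {a b : X} (hab : a ≤ b) :
    ∃ s : CompositionSeries X, s.head = a ∧ s.last = b := by
  induction a using WellFoundedGT.induction with
  | ind a ih =>
    rcases hab.eq_or_lt with rfl | hlt
    · exact ⟨RelSeries.singleton _ a, rfl, rfl⟩
    · obtain ⟨c, hac, hcb⟩ := exists_covBy_le_of_lt hlt
      obtain ⟨s, rfl, hs⟩ := ih c hac.lt hcb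
      exact ⟨s.cons a hac, RelSeries.head_cons _ _ _, (RelSeries.last_cons _ _ _).trans hs⟩

/-- In a module of finite length, the composition factors are the simple subquotients. A subquotient
`L` is given by a surjection from a submodule onto `L`. -/
theorem isCompositionFactor_iff {R L M : Type*} [Ring R] [AddCommGroup L] [Module R L]
    [AddCommGroup M] [Module R M] [IsNoetherian R M] [IsArtinian R M] :
    IsCompositionFactor R L M ↔
      IsSimpleModule R L ∧ ∃ (P : Submodule R M) (f : P →ₗ[R] L), Function.Surjective f := by
  constructor
  · rintro ⟨s, -, -, i, ⟨e⟩⟩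
    have hcov : s i.castSucc ⋖ s i.succ := s.step i
    have := (covBy_iff_quot_is_simple hcov.le).1 hcov
    exact ⟨IsSimpleModule.congr e.symm, s i.succ, e.toLinearMap ∘ₗ Submodule.mkQ _,
      e.surjective.comp (Submodule.mkQ_surjective _)⟩
  · rintro ⟨hL, P, f, hf⟩
    set N : Submodule R M := (LinearMap.ker f).map P.subtype with hN
    have hNP : N ≤ P := Submodule.map_subtype_le _ _
    have hcomap : N.comap P.subtype = LinearMap.ker f :=
      Submodule.comap_map_eq_of_injective P.injective_subtype _
    have e : (P ⧸ N.comap P.subtype) ≃ₗ[R] L :=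
      (Submodule.quotEquivOfEq _ _ hcomap).trans (f.quotKerEquivOfSurjective hf)
    have hcov : N ⋖ P := (covBy_iff_quot_is_simple hNP).2 (IsSimpleModule.congr e)
    obtain ⟨s, hs, hsN⟩ := exists_compositionSeries_of_le (bot_le : ⊥ ≤ N)
    obtain ⟨t, htP, ht⟩ := exists_compositionSeries_of_le (le_top : P ≤ ⊤)
    -- The series through `N ⋖ P`, with the step from `N` to `P` at position `s.length`.
    have hst : (s.snoc P (hsN ▸ hcov)).last = t.head := by rw [RelSeries.last_snoc, htP]
    refine ⟨(s.snoc P (hsN ▸ hcov)).smash t hst, ?_, ?_,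
      Fin.castAdd t.length (Fin.last s.length), ?_⟩
    · rw [RelSeries.head_smash, RelSeries.head_snoc, hs]
    · rw [RelSeries.last_smash, ht]
    · have h1 : ((s.snoc P (hsN ▸ hcov)).smash t hst)
          (Fin.castAdd t.length (Fin.last s.length)).castSucc = N := by
        refine (RelSeries.smash_castAdd hst (Fin.last s.length)).trans ?_
        exact (RelSeries.snoc_castSucc _ _ _ _).trans hsN
      have h2 : ((s.snoc P (hsN ▸ hcov)).smash t hst)
          (Fin.castAdd t.length (Fin.last s.length)).succ = P := by
        refine (RelSeries.smash_succ_castAdd hst (Fin.last s.length)).trans ?_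
        exact RelSeries.last_snoc _ _ _
      have key : ∀ N' P' : Submodule R M, N' = N → P' = P →
          Nonempty ((P' ⧸ N'.comap P'.subtype) ≃ₗ[R] L) := by
        rintro _ _ rfl rfl
        exact ⟨e⟩
      exact key _ _ h1 h2

/-! ### Corners of modules -/

/-- Let `e` be an idempotent of `A`, and let `φ : C → A` identify `C` with the corner `e A e`.
Then `IsCornerModule e φ α` says that the additive map `α : N → M` identifies the `C`-module `N` with
the corner `e M` of the `A`-module `M`. Working with `α` avoids the ring `e A e` itself. -/
structure IsCornerModule {A C N M : Type*} [Ring A] [Ring C] [AddCommGroup N] [Module C N]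
    [AddCommGroup M] [Module A M] (e : A) (φ : C → A) (α : N →+ M) : Prop where
  injective : Function.Injective α
  map_smul : ∀ c n, α (c • n) = φ c • α n
  mem_range_iff : ∀ m, m ∈ Set.range α ↔ e • m = m

namespace IsCornerModule

variable {A C N M N' M' : Type*} [Ring A] [Ring C] [AddCommGroup N] [Module C N]
  [AddCommGroup M] [Module A M] [AddCommGroup N'] [Module C N'] [AddCommGroup M'] [Module A M']
  {e : A} {φ : C → A} {α : N →+ M} {β : N' →+ M'}

theorem smul_apply (hα : IsCornerModule e φ α) (n : N) : e • α n = α n :=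
  (hα.mem_range_iff _).1 ⟨n, rfl⟩

/-- The preimage of an `A`-submodule `S` of `M`; it stands for the corner `e S`. -/
def comap (hα : IsCornerModule e φ α) (S : Submodule A M) : Submodule C N where
  carrier := {n | α n ∈ S}
  zero_mem' := by simp
  add_mem' := fun {x y} hx hy => by
    change α (x + y) ∈ S
    rw [map_add]
    exact S.add_mem hx hy
  smul_mem' := fun c x hx => by
    change α (c • x) ∈ S
    rw [hα.map_smul]
    exact S.smul_mem _ hx

theorem mem_comap (hα : IsCornerModule e φ α) {S : Submodule A M} {n : N} :
    n ∈ hα.comap S ↔ α n ∈ S := Iff.rfl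

/-- Passing to the corner is exact, so a subquotient of `M` isomorphic to `M'` restricts to a
subquotient of `N` isomorphic to `N'`. -/
theorem exists_surjective_of_ambient (hα : IsCornerModule e φ α) (hβ : IsCornerModule e φ β)
    (he : IsIdempotentElem e)
    (h : ∃ (P : Submodule A M) (f : P →ₗ[A] M'), Function.Surjective f) :
    ∃ (Q : Submodule C N) (g : Q →ₗ[C] N'), Function.Surjective g := by
  obtain ⟨P, f, hf⟩ := h
  have hfix : ∀ n : hα.comap P, ∃ y, β y = f ⟨α n, n.2⟩ := fun n => by
    refine (hβ.mem_range_iff _).2 ?_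
    rw [← f.map_smul]
    exact congrArg f (Subtype.ext (hα.smul_apply _))
  choose g hg using hfix
  refine ⟨hα.comap P, ⟨⟨g, fun x y => ?_⟩, fun c x => ?_⟩, fun y => ?_⟩
  · apply hβ.injective
    rw [map_add, hg, hg, hg, ← map_add]
    exact congrArg f (Subtype.ext (map_add α _ _))
  · apply hβ.injective
    rw [RingHom.id_apply, hβ.map_smul, hg, hg, ← f.map_smul]
    exact congrArg f (Subtype.ext (hα.map_smul _ _))
  · obtain ⟨p, hp⟩ := hf (β y)
    obtain ⟨n, hn⟩ := (hα.mem_range_iff (e • (p : M))).2 (by rw [smul_smul, he.eq])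
    have hmem : α n ∈ P := hn ▸ P.smul_mem e p.2
    refine ⟨⟨n, hmem⟩, hβ.injective ?_⟩
    rw [LinearMap.coe_mk, AddHom.coe_mk, hg,
      show (⟨α n, hmem⟩ : P) = e • p from Subtype.ext hn, f.map_smul, hp, hβ.smul_apply]

/-- A subquotient of the corner `N` isomorphic to `N'` lifts to a subquotient of `M` isomorphic to
`M'`, if `M'` is generated by its corner and has no nonzero submodule with zero corner: the
`A`-span of the graph of the given map is again the graph of a map. -/
theorem exists_surjective_of_corner (hα : IsCornerModule e φ α) (hβ : IsCornerModule e φ β)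
    (hφ : ∀ a, ∃ c, e * a * e = φ c) (hgen : Submodule.span A (Set.range β) = ⊤)
    (hsoc : ∀ y : M', (∀ a : A, e • a • y = 0) → y = 0)
    (h : ∃ (Q : Submodule C N) (g : Q →ₗ[C] N'), Function.Surjective g) :
    ∃ (P : Submodule A M) (f : P →ₗ[A] M'), Function.Surjective f := by
  obtain ⟨Q, g, hg⟩ := h
  set Γ : Submodule A (M × M') :=
    Submodule.span A (Set.range fun q : Q => (α q, β (g q))) with hΓ
  -- The corner of the span of the graph of `g` is that graph itself.
  have hcorner : ∀ z ∈ Γ, ∀ a : A, ∃ q : Q, e • a • z = (α q, β (g q)) := by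
    intro z hz
    induction hz using Submodule.span_induction with
    | zero => exact fun a => ⟨0, by simp [← Prod.zero_eq_mk]⟩
    | add z w _ _ hz hw =>
      intro a
      obtain ⟨q, hq⟩ := hz a
      obtain ⟨q', hq'⟩ := hw a
      exact ⟨q + q', by simp [smul_add, hq, hq']⟩
    | smul b z _ hz =>
      intro a
      obtain ⟨q, hq⟩ := hz (a * b)
      exact ⟨q, by rw [← hq, mul_smul]⟩
    | mem z hz =>
      intro a
      obtain ⟨q, rfl⟩ := hz
      obtain ⟨c, hc⟩ := hφ a
      refine ⟨c • q, Prod.ext ?_ ?_⟩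
      · change e • a • α q = α (c • q)
        rw [hα.map_smul, ← hc, mul_smul, mul_smul, hα.smul_apply]
      · change e • a • β (g q) = β (g (c • q))
        rw [g.map_smul, hβ.map_smul, ← hc, mul_smul, mul_smul, hβ.smul_apply]
  have hfun : ∀ z ∈ Γ, z.1 = 0 → z.2 = 0 := by
    intro z hz h0
    refine hsoc _ fun a => ?_
    obtain ⟨q, hq⟩ := hcorner z hz a
    have h1 : α q = 0 := (congrArg Prod.fst hq).symm.trans (by simp [h0])
    rw [← map_zero α] at h1
    have h2 : q = 0 := Subtype.ext (hα.injective h1)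
    exact (congrArg Prod.snd hq).trans (by simp [h2])
  have hinj : Function.Injective ((LinearMap.fst A M M').domRestrict Γ) := by
    rw [← LinearMap.ker_eq_bot, LinearMap.ker_eq_bot']
    intro z hz
    exact Subtype.ext (Prod.ext hz (hfun z z.2 hz))
  refine ⟨_, (LinearMap.snd A M M').domRestrict Γ ∘ₗ
    (LinearEquiv.ofInjective _ hinj).symm.toLinearMap, ?_⟩
  rw [LinearMap.coe_comp]
  refine Function.Surjective.comp ?_ (LinearEquiv.surjective _)
  rw [← LinearMap.range_eq_top, LinearMap.range_domRestrict, eq_top_iff, ← hgen, Submodule.span_le]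
  rintro _ ⟨y, rfl⟩
  obtain ⟨q, rfl⟩ := hg y
  exact ⟨_, Submodule.subset_span ⟨q, rfl⟩, rfl⟩

/-- A module that is generated by its corner and has no nonzero submodule with zero corner is simple
if and only if its corner is. -/
theorem isSimpleModule_iff (hβ : IsCornerModule e φ β) (he : IsIdempotentElem e)
    (hφ : ∀ a, ∃ c, e * a * e = φ c)
    (hgen : Submodule.span A (Set.range β) = ⊤)
    (hsoc : ∀ y : M', (∀ a : A, e • a • y = 0) → y = 0) :
    IsSimpleModule C N' ↔ IsSimpleModule A M' := by
  rw [_root_.isSimpleModule_iff, _root_.isSimpleModule_iff]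
  constructor
  · intro hs
    have : Nontrivial N' := (Submodule.nontrivial_iff C).1 inferInstance
    have : Nontrivial (Submodule A M') := (Submodule.nontrivial_iff A).2 hβ.injective.nontrivial
    refine ⟨fun S => ?_⟩
    rcases eq_bot_or_eq_top (hβ.comap S) with h | h
    · refine Or.inl ((Submodule.eq_bot_iff _).2 fun y hy => hsoc y fun a => ?_)
      obtain ⟨n, hn⟩ := (hβ.mem_range_iff (e • a • y)).2 (by rw [smul_smul, he.eq])
      have hn0 : n ∈ hβ.comap S := by
        rw [mem_comap, hn]
        exact S.smul_mem _ (S.smul_mem _ hy)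
      rw [h, Submodule.mem_bot] at hn0
      rw [← hn, hn0, map_zero]
    · refine Or.inr (eq_top_iff.2 ?_)
      rw [← hgen, Submodule.span_le]
      rintro _ ⟨n, rfl⟩
      exact hβ.mem_comap.1 (h ▸ Submodule.mem_top)
  · intro hs
    have : Nontrivial M' := (Submodule.nontrivial_iff A).1 inferInstance
    have hN : Nontrivial N' := by
      by_contra hN
      rw [not_nontrivial_iff_subsingleton] at hN
      refine top_ne_bot (α := Submodule A M') ?_
      rw [← hgen, Submodule.span_eq_bot]
      rintro _ ⟨n, rfl⟩
      rw [Subsingleton.elim n 0, map_zero]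
    have : Nontrivial (Submodule C N') := (Submodule.nontrivial_iff C).2 hN
    refine ⟨fun T => or_iff_not_imp_left.2 fun hT => eq_top_iff.2 fun n _ => ?_⟩
    obtain ⟨t, ht, ht0⟩ := (Submodule.ne_bot_iff _).1 hT
    have htop : Submodule.span A {β t} = ⊤ := by
      refine (eq_bot_or_eq_top _).resolve_left fun h => ht0 (hβ.injective ?_)
      rw [map_zero, Submodule.span_singleton_eq_bot.1 h]
    obtain ⟨a, ha⟩ := Submodule.mem_span_singleton.1 (htop ▸ Submodule.mem_top : β n ∈ _)
    obtain ⟨c, hc⟩ := hφ a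
    have hn : n = c • t := hβ.injective (by
      rw [hβ.map_smul, ← hc, mul_smul, mul_smul, hβ.smul_apply, ha, hβ.smul_apply])
    exact hn ▸ T.smul_mem c ht

end IsCornerModule

/-! ### Diagrams with an arc at the end of the top row -/

namespace BrauerDiagram

variable {m n p r t : ℕ}

/-- An arc in the bottom row of `b` remains an arc in the bottom row of `a.comp b`. -/
theorem throughStrings_comp_le (a : BrauerDiagram m n) (b : BrauerDiagram n p) :
    (a.comp b).throughStrings ≤ b.throughStrings := by
  refine Nat.card_le_card_of_injective
    (fun j : {j : Fin p // ∃ i, (a.comp b).graph.Adj (Sum.inl i) (Sum.inr j)} =>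
      (⟨j.1, ?_⟩ : {j : Fin p // ∃ i, b.graph.Adj (Sum.inl i) (Sum.inr j)}))
    fun j k h => Subtype.ext (Subtype.mk.inj h)
  obtain ⟨j, i, hij⟩ := j
  obtain ⟨w, hw, -⟩ := b.existsUnique_adj (Sum.inr j)
  rcases w with k | k
  · exact ⟨k, hw.symm⟩
  · have hjk : (a.comp b).graph.Adj (Sum.inr j) (Sum.inr k) :=
      ⟨fun h => hw.ne (congrArg Sum.inr (Sum.inr_injective h)),
        (stack_adj.2 (Or.inr ⟨Sum.inr j, Sum.inr k, hw, rfl, rfl⟩)).reachable⟩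
    exact absurd ((a.comp b).adj_unique hij.symm hjk) (by simp)

/-- The diagram with `r + 2` top points and `r` bottom points which joins the last two top points
to each other, and every other top point to the bottom point below it. -/
def cup (r : ℕ) : BrauerDiagram (r + 2) r where
  graph :=
    { Adj := fun v w =>
        (∃ i : Fin r, (v = Sum.inl (Fin.castAdd 2 i) ∧ w = Sum.inr i) ∨
          (v = Sum.inr i ∧ w = Sum.inl (Fin.castAdd 2 i))) ∨
        ∃ i : Fin 2, v = Sum.inl (Fin.natAdd r i) ∧ w = Sum.inl (Fin.natAdd r (1 - i))
      symm := ⟨by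
        rintro _ _ (⟨i, ⟨rfl, rfl⟩ | ⟨rfl, rfl⟩⟩ | ⟨i, rfl, rfl⟩)
        · exact Or.inl ⟨i, Or.inr ⟨rfl, rfl⟩⟩
        · exact Or.inl ⟨i, Or.inl ⟨rfl, rfl⟩⟩
        · exact Or.inr ⟨1 - i, rfl, by rw [sub_sub_cancel]⟩⟩
      loopless := ⟨by
        rintro _ (⟨i, ⟨rfl, h⟩ | ⟨rfl, h⟩⟩ | ⟨i, rfl, h⟩)
        · cases h
        · cases h
        · have := Fin.natAdd_injective 2 r (Sum.inl_injective h)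
          clear h
          revert i
          decide⟩ }
  existsUnique_adj := by
    rintro (v | v)
    · induction v using Fin.addCases with
      | left i =>
        refine ⟨Sum.inr i, Or.inl ⟨i, Or.inl ⟨rfl, rfl⟩⟩, ?_⟩
        rintro _ (⟨j, ⟨h, rfl⟩ | ⟨h, rfl⟩⟩ | ⟨j, h, rfl⟩)
        · rw [Fin.castAdd_injective r 2 (Sum.inl_injective h)]
        · cases h
        · have := congrArg Fin.val (Sum.inl_injective h)
          simp only [Fin.val_castAdd, Fin.val_natAdd] at this
          omega
      | right i =>
        refine ⟨Sum.inl (Fin.natAdd r (1 - i)), Or.inr ⟨i, rfl, rfl⟩, ?_⟩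
        rintro _ (⟨j, ⟨h, rfl⟩ | ⟨h, rfl⟩⟩ | ⟨j, h, rfl⟩)
        · have := congrArg Fin.val (Sum.inl_injective h)
          simp only [Fin.val_castAdd, Fin.val_natAdd] at this
          omega
        · cases h
        · rw [Fin.natAdd_injective 2 r (Sum.inl_injective h)]
    · refine ⟨Sum.inl (Fin.castAdd 2 v), Or.inl ⟨v, Or.inr ⟨rfl, rfl⟩⟩, ?_⟩
      rintro _ (⟨j, ⟨h, rfl⟩ | ⟨h, rfl⟩⟩ | ⟨j, h, rfl⟩)
      · cases h
      · rw [Sum.inr_injective h]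
      · cases h

theorem colorMatrix_cup (x : Fin (r + 2) → Bool) (y : Fin r → Bool) :
    colorMatrix (cup r) x y =
      if ∃ b : Bool, x = Fin.append y (fun _ => b) then 1 else 0 := by
  rw [colorMatrix]
  congr 1
  rw [eq_iff_iff]
  constructor
  · intro h
    refine ⟨x (Fin.natAdd r 0), funext fun i => ?_⟩
    induction i using Fin.addCases with
    | left i => rw [Fin.append_left]; exact h _ _ (Or.inl ⟨i, Or.inl ⟨rfl, rfl⟩⟩)
    | right i =>
      rw [Fin.append_right]
      fin_cases i
      · rfl
      · exact h _ _ (Or.inr ⟨1, rfl, rfl⟩)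
  · rintro ⟨b, rfl⟩ _ _ (⟨i, ⟨rfl, rfl⟩ | ⟨rfl, rfl⟩⟩ | ⟨i, rfl, rfl⟩) <;> simp

theorem colorMatrix_flip_cup_mul (d : BrauerDiagram (r + 2) n) (y : Fin r → Bool)
    (z : Fin n → Bool) :
    (colorMatrix (cup r).flip * colorMatrix d) y z =
      ∑ b : Bool, colorMatrix d (Fin.append y fun _ => b) z := by
  classical
  have hinj : Function.Injective fun b : Bool => (Fin.append y fun _ => b : Fin (r + 2) → Bool) :=
    fun b c h => by simpa using congrFun h (Fin.natAdd r 0)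
  rw [Matrix.mul_apply, ← Finset.sum_image (s := Finset.univ) (g := fun b : Bool =>
    (Fin.append y fun _ => b : Fin (r + 2) → Bool)) (f := fun x => colorMatrix d x z)
    (fun _ _ _ _ h => hinj h), ← Finset.sum_subset (Finset.subset_univ (Finset.univ.image
      fun b : Bool => (Fin.append y fun _ => b : Fin (r + 2) → Bool)))]
  · refine Finset.sum_congr rfl fun x hx => ?_
    obtain ⟨b, -, rfl⟩ := Finset.mem_image.1 hx
    rw [colorMatrix_flip, Matrix.transpose_apply, colorMatrix_cup, if_pos ⟨b, rfl⟩, one_mul]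
  · intro x _ hx
    rw [colorMatrix_flip, Matrix.transpose_apply, colorMatrix_cup, if_neg, zero_mul]
    rintro ⟨b, rfl⟩
    exact hx (Finset.mem_image_of_mem _ (Finset.mem_univ b))

theorem flip_cup_comp_cup :
    loops (cup r).flip (cup r) = 1 ∧ comp (cup r).flip (cup r) = ofPerm 1 := by
  apply comp_loops_eq_of_mul
  ext x y
  have h : ∀ b : Bool, (∃ c : Bool, (Fin.append x fun _ => b : Fin (r + 2) → Bool) =
      Fin.append y fun _ => c) ↔ x = y := by
    refine fun b => ⟨fun ⟨c, hc⟩ => ?_, fun h => ⟨b, by rw [h]⟩⟩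
    funext i
    simpa using congrFun hc (Fin.castAdd 2 i)
  rw [colorMatrix_flip_cup_mul, Matrix.smul_apply, colorMatrix_ofPerm]
  simp [colorMatrix_cup, h]

/-- The two points of an arc of `d` impose no condition on their common colour. -/
theorem colorMatrix_append_eq (d : BrauerDiagram (r + 2) n)
    (hd : d.graph.Adj (Sum.inl (Fin.natAdd r 0)) (Sum.inl (Fin.natAdd r 1)))
    (y : Fin r → Bool) (z : Fin n → Bool) (b c : Bool) :
    colorMatrix d (Fin.append y fun _ => b) z = colorMatrix d (Fin.append y fun _ => c) z := by
  have key : ∀ b c : Bool,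
      (∀ v w, d.graph.Adj v w → Sum.elim (Fin.append y fun _ : Fin 2 => b) z v =
        Sum.elim (Fin.append y fun _ : Fin 2 => b) z w) →
      ∀ v w, d.graph.Adj v w → Sum.elim (Fin.append y fun _ : Fin 2 => c) z v =
        Sum.elim (Fin.append y fun _ : Fin 2 => c) z w := by
    intro b c h v w hvw
    by_cases hv : ∃ i : Fin 2, v = Sum.inl (Fin.natAdd r i)
    · obtain ⟨i, rfl⟩ := hv
      have hw : w = Sum.inl (Fin.natAdd r (1 - i)) := by
        fin_cases i
        · exact d.adj_unique hvw hd
        · exact d.adj_unique hvw hd.symm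
      rw [hw, Sum.elim_inl, Sum.elim_inl, Fin.append_right, Fin.append_right]
    · have hw : ¬ ∃ i : Fin 2, w = Sum.inl (Fin.natAdd r i) := by
        rintro ⟨i, rfl⟩
        refine hv ⟨1 - i, ?_⟩
        fin_cases i
        · exact d.adj_unique hvw.symm hd
        · exact d.adj_unique hvw.symm hd.symm
      have he : ∀ u : Fin (r + 2) ⊕ Fin n, (¬ ∃ i : Fin 2, u = Sum.inl (Fin.natAdd r i)) →
          Sum.elim (Fin.append y fun _ : Fin 2 => c) z u =
            Sum.elim (Fin.append y fun _ : Fin 2 => b) z u := by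
        rintro (u | u) hu
        · induction u using Fin.addCases with
          | left i => rw [Sum.elim_inl, Sum.elim_inl, Fin.append_left, Fin.append_left]
          | right i => exact (hu ⟨i, rfl⟩).elim
        · rfl
      rw [he v hv, he w hw]
      exact h v w hvw
  rw [colorMatrix, colorMatrix]
  congr 1
  exact propext ⟨key b c, key c b⟩

/-- A diagram which joins the last two top points absorbs the cup followed by its reflection, up to
the removal of one closed loop. -/
theorem cup_comp_flip_cup_comp (d : BrauerDiagram (r + 2) n)
    (hd : d.graph.Adj (Sum.inl (Fin.natAdd r 0)) (Sum.inl (Fin.natAdd r 1))) :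
    loops (cup r).flip d + loops (cup r) (comp (cup r).flip d) = 1 ∧
      comp (cup r) (comp (cup r).flip d) = d := by
  apply smul_colorMatrix_inj
  rw [pow_add, mul_smul, ← colorMatrix_mul, ← Matrix.mul_smul, ← colorMatrix_mul]
  ext x z
  rw [Matrix.mul_apply, Matrix.smul_apply]
  simp only [colorMatrix_flip_cup_mul, colorMatrix_cup]
  -- Both sides vanish at colourings `x` that distinguish the ends of the arc; at the others, the two
  -- colours of the arc contribute equally, and this produces the factor `2`.
  by_cases hx : x (Fin.natAdd r 0) = x (Fin.natAdd r 1)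
  · have hxy : x = Fin.append (fun i => x (Fin.castAdd 2 i)) fun _ => x (Fin.natAdd r 0) := by
      funext i
      induction i using Fin.addCases with
      | left i => rw [Fin.append_left]
      | right i =>
        rw [Fin.append_right]
        fin_cases i
        · rfl
        · exact hx.symm
    rw [Finset.sum_eq_single fun i => x (Fin.castAdd 2 i)]
    · rw [if_pos ⟨_, hxy⟩, one_mul, Finset.sum_congr rfl fun b _ =>
        colorMatrix_append_eq d hd _ z b (x (Fin.natAdd r 0)), ← hxy]
      simp
    · intro y _ hy
      rw [if_neg, zero_mul]
      rintro ⟨b, rfl⟩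
      exact hy (funext fun i => by rw [Fin.append_left])
    · exact fun h => (h (Finset.mem_univ _)).elim
  · rw [Finset.sum_eq_zero, colorMatrix, if_neg fun h => hx (h _ _ hd), smul_zero]
    intro y _
    rw [if_neg, zero_mul]
    rintro ⟨b, rfl⟩
    exact hx (by rw [Fin.append_right, Fin.append_right])

theorem adj_ofPerm_comp (σ : Equiv.Perm (Fin m)) (d : BrauerDiagram m n) {i j : Fin m}
    (h : d.graph.Adj (Sum.inl i) (Sum.inl j)) :
    ((ofPerm σ).comp d).graph.Adj (Sum.inl (σ i)) (Sum.inl (σ j)) := by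
  refine ⟨fun hij => h.ne (by simpa using hij), ?_⟩
  have h1 : ∀ k, (stack (ofPerm σ) d).Reachable (outer (Sum.inl (σ k))) (lower (Sum.inl k)) :=
    fun k => (stack_adj.2 (Or.inl ⟨Sum.inl (σ k), Sum.inr k, Or.inl ⟨k, rfl, rfl⟩, rfl,
      rfl⟩)).reachable
  exact (h1 i).trans ((stack_adj.2 (Or.inr ⟨_, _, h, rfl, rfl⟩)).reachable.trans (h1 j).symm)

theorem exists_adj_inl_inl (d : BrauerDiagram m n) (h : n < m) :
    ∃ i j, d.graph.Adj (Sum.inl i) (Sum.inl j) := by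
  by_contra! hd
  have hex : ∀ i, ∃ k, d.graph.Adj (Sum.inl i) (Sum.inr k) := fun i => by
    obtain ⟨w, hw, -⟩ := d.existsUnique_adj (Sum.inl i)
    rcases w with j | k
    · exact (hd i j hw).elim
    · exact ⟨k, hw⟩
  choose f hf using hex
  have hinj : Function.Injective f := fun i j hij =>
    Sum.inl_injective (d.adj_unique (hf i).symm (hij ▸ (hf j).symm))
  exact absurd (Fintype.card_le_of_injective f hinj) (by simpa using h)

theorem exists_perm_adj (d : BrauerDiagram (r + 2) n) (h : n < r + 2) :
    ∃ σ : Equiv.Perm (Fin (r + 2)), ((ofPerm σ).comp d).graph.Adj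
      (Sum.inl (Fin.natAdd r 0)) (Sum.inl (Fin.natAdd r 1)) := by
  obtain ⟨i, j, hij⟩ := d.exists_adj_inl_inl h
  have hne : i ≠ j := fun h => hij.ne (congrArg Sum.inl h)
  obtain ⟨σ, hσ⟩ : ∃ σ : Equiv.Perm (Fin (r + 2)),
      σ i = Fin.natAdd r 0 ∧ σ j = Fin.natAdd r 1 := by
    set τ := Equiv.swap i (Fin.natAdd r (0 : Fin 2)) with hτ
    have hτi : τ i = Fin.natAdd r 0 := Equiv.swap_apply_left _ _
    refine ⟨Equiv.swap (τ j) (Fin.natAdd r 1) * τ, ?_, ?_⟩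
    · rw [Equiv.Perm.mul_apply, hτi, Equiv.swap_apply_of_ne_of_ne]
      · exact fun h => hne (τ.injective (hτi.trans h))
      · exact fun h => absurd (Fin.natAdd_injective 2 r h) (by decide)
    · rw [Equiv.Perm.mul_apply, Equiv.swap_apply_left]
  refine ⟨σ, ?_⟩
  rw [← hσ.1, ← hσ.2]
  exact adj_ofPerm_comp σ d hij

end BrauerDiagram

open scoped TensorProduct

/-! ### Functoriality of the cell modules in the number of points -/

instance (m n : ℕ) : Finite (BrauerDiagram m n) :=
  Finite.of_injective BrauerDiagram.graph fun _ _ h => BrauerDiagram.ext h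

namespace BrauerHom

variable {K : Type*} [Field K] {δ : K} {m n p q r : ℕ}

instance : Module.Finite K (BrauerHom K δ m n) :=
  inferInstanceAs (Module.Finite K (BrauerDiagram m n →₀ K))

theorem induction_on {P : BrauerHom K δ m n → Prop} (x : BrauerHom K δ m n)
    (diagram : ∀ d, P (ofDiagram d)) (zero : P 0) (add : ∀ x y, P x → P y → P (x + y))
    (smul : ∀ (c : K) x, P x → P (c • x)) : P x := by
  have hx : x ∈ Submodule.span K (Set.range (ofDiagram (K := K) (δ := δ) (m := m) (n := n))) := by
    have := congrArg (fun f : BrauerHom K δ m n →ₗ[K] _ => f x)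
      (hom_ext (f := (Submodule.span K (Set.range ofDiagram)).mkQ) (g := 0) fun d =>
        (Submodule.Quotient.mk_eq_zero _).2 (Submodule.subset_span (Set.mem_range_self d)))
    exact (Submodule.Quotient.mk_eq_zero _).1 this
  induction hx using Submodule.span_induction with
  | zero => exact zero
  | add _ _ _ _ h h' => exact add _ _ h h'
  | smul c _ _ h => exact smul c _ h
  | mem _ h => obtain ⟨d, rfl⟩ := h; exact diagram d

/-- The cup, as a morphism from `r` to `r + 2` points. -/
noncomputable def cup (K : Type*) [Field K] (δ : K) (r : ℕ) : BrauerHom K δ (r + 2) r :=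
  ofDiagram (BrauerDiagram.cup r)

theorem flip_cup_comp_cup :
    comp (flip (cup K δ r)) (cup K δ r) = δ • ofDiagram (BrauerDiagram.ofPerm 1) := by
  rw [cup, flip_ofDiagram, comp_ofDiagram, BrauerDiagram.flip_cup_comp_cup.1,
    BrauerDiagram.flip_cup_comp_cup.2, pow_one]

/-- A diagram with an arc in its top row factors through the cup. -/
theorem exists_comp_cup_comp (hδ : δ ≠ 0) (d : BrauerDiagram (r + 2) n) (h : n < r + 2) :
    ∃ (a : BrauerHom K δ (r + 2) (r + 2)) (x : BrauerHom K δ r n),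
      ofDiagram d = comp a (comp (cup K δ r) x) := by
  obtain ⟨σ, hσ⟩ := d.exists_perm_adj h
  set d' := (BrauerDiagram.ofPerm σ).comp d with hd'
  have hd : (BrauerDiagram.ofPerm σ⁻¹).comp d' = d := by
    rw [hd', ← (BrauerDiagram.comp_assoc_aux _ _ _).2, (BrauerDiagram.ofPerm_comp_ofPerm _ _).2,
      inv_mul_cancel, (BrauerDiagram.one_comp _).2]
  obtain ⟨h1, h2⟩ := BrauerDiagram.cup_comp_flip_cup_comp d' hσ
  refine ⟨δ⁻¹ • ofDiagram (BrauerDiagram.ofPerm σ⁻¹),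
    comp (flip (cup K δ r)) (ofDiagram d'), ?_⟩
  rw [cup, flip_ofDiagram, comp_ofDiagram, map_smul (comp (ofDiagram _)), comp_ofDiagram, smul_smul,
    ← pow_add, h1, h2, pow_one, map_smul, map_smul comp, LinearMap.smul_apply, smul_smul,
    mul_inv_cancel₀ hδ, one_smul, comp_ofDiagram, BrauerDiagram.ofPerm_comp_loops, pow_zero, one_smul, hd]

end BrauerHom

section CellMap

variable {K : Type*} [Field K] {δ : K} {p q r : ℕ} {ν : YoungDiagram}

instance : Module.Finite K (specht K ν) :=
  Module.Finite.span_of_finite K (Set.finite_range _)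

instance : Module.Finite K (CellModule K δ r ν) :=
  Module.Finite.equiv (Submodule.Quotient.restrictScalarsEquiv K (cellRelations K δ r ν))

instance : IsNoetherian (BrauerAlgebra K δ r) (CellModule K δ r ν) :=
  isNoetherian_of_tower K inferInstance

instance : IsArtinian (BrauerAlgebra K δ r) (CellModule K δ r ν) :=
  isArtinian_of_tower K inferInstance

/-- Composition with a morphism from `r` to `p` points, before passage to the cell modules. -/
noncomputable def preCellMap (ν : YoungDiagram) (h : BrauerHom K δ p r) :
    BrauerHom K δ r ν.card ⊗[K] specht K ν →ₗ[K] BrauerHom K δ p ν.card ⊗[K] specht K ν :=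
  (BrauerHom.comp h).rTensor (specht K ν)

theorem preCellMap_tmul (h : BrauerHom K δ p r) (x : BrauerHom K δ r ν.card) (s : specht K ν) :
    preCellMap ν h (x ⊗ₜ s) = BrauerHom.comp h x ⊗ₜ s := rfl

theorem preCellMap_comp (h : BrauerHom K δ p q) (g : BrauerHom K δ q r)
    (z : BrauerHom K δ r ν.card ⊗[K] specht K ν) :
    preCellMap ν (BrauerHom.comp h g) z = preCellMap ν h (preCellMap ν g z) := by
  induction z using TensorProduct.induction_on with
  | zero => simp
  | add z w hz hw => rw [map_add, map_add, map_add, hz, hw]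
  | tmul x s => rw [preCellMap_tmul, preCellMap_tmul, preCellMap_tmul, BrauerHom.comp_assoc]

theorem preCellMap_toHom (b : BrauerAlgebra K δ r)
    (z : BrauerHom K δ r ν.card ⊗[K] specht K ν) : preCellMap ν b.toHom z = b • z := by
  induction z using TensorProduct.induction_on with
  | zero => simp
  | add z w hz hw => rw [map_add, smul_add, hz, hw]
  | tmul x s => rw [preCellMap_tmul, TensorProduct.smul_tmul', BrauerAlgebra.smul_def]

theorem preCellMap_mem_cellRelations (h : BrauerHom K δ p r)
    {z : BrauerHom K δ r ν.card ⊗[K] specht K ν} (hz : z ∈ cellRelations K δ r ν) :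
    preCellMap ν h z ∈ cellRelations K δ p ν := by
  induction hz using Submodule.span_induction generalizing h with
  | zero => simp
  | add z w _ _ hz hw => rw [map_add]; exact add_mem (hz h) (hw h)
  | smul b z _ hz => rw [← preCellMap_toHom, ← preCellMap_comp]; exact hz _
  | mem z hz =>
    rcases hz with ⟨d, s, hd, rfl⟩ | ⟨x, σ, s, rfl⟩
    · rw [preCellMap_tmul]
      induction h using BrauerHom.induction_on with
      | diagram a =>
        rw [BrauerHom.comp_ofDiagram, ← TensorProduct.smul_tmul']
        exact Submodule.smul_of_tower_mem _ _ (Submodule.subset_span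
          (Or.inl ⟨_, _, (BrauerDiagram.throughStrings_comp_le a d).trans_lt hd, rfl⟩))
      | zero => simp
      | add x y hx hy =>
        rw [map_add, LinearMap.add_apply, TensorProduct.add_tmul]
        exact add_mem hx hy
      | smul c x hx =>
        rw [map_smul, LinearMap.smul_apply, ← TensorProduct.smul_tmul']
        exact Submodule.smul_of_tower_mem _ _ hx
    · rw [map_sub, preCellMap_tmul, preCellMap_tmul, ← BrauerHom.comp_assoc]
      exact Submodule.subset_span (Or.inr ⟨_, _, _, rfl⟩)

/-- Composition with a morphism from `r` to `p` points, as a map from `W_r(ν)` to `W_p(ν)`. -/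
noncomputable def cellMap (ν : YoungDiagram) (h : BrauerHom K δ p r) :
    CellModule K δ r ν →+ CellModule K δ p ν :=
  QuotientAddGroup.map (cellRelations K δ r ν).toAddSubgroup (cellRelations K δ p ν).toAddSubgroup
    (preCellMap ν h).toAddMonoidHom fun _ hz => preCellMap_mem_cellRelations h hz

theorem cellMap_mk (h : BrauerHom K δ p r) (z : BrauerHom K δ r ν.card ⊗[K] specht K ν) :
    cellMap ν h (Submodule.Quotient.mk z) = Submodule.Quotient.mk (preCellMap ν h z) := rfl

theorem cellMap_comp (h : BrauerHom K δ p q) (g : BrauerHom K δ q r) (z : CellModule K δ r ν) :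
    cellMap ν (BrauerHom.comp h g) z = cellMap ν h (cellMap ν g z) := by
  obtain ⟨z, rfl⟩ := Submodule.Quotient.mk_surjective _ z
  rw [cellMap_mk, cellMap_mk, cellMap_mk, preCellMap_comp]

theorem cellMap_toHom (b : BrauerAlgebra K δ r) (z : CellModule K δ r ν) :
    cellMap ν b.toHom z = b • z := by
  obtain ⟨z, rfl⟩ := Submodule.Quotient.mk_surjective _ z
  rw [cellMap_mk, preCellMap_toHom, Submodule.Quotient.mk_smul]

theorem preCellForm_preCellMap (h : BrauerHom K δ p r)
    (z : BrauerHom K δ r ν.card ⊗[K] specht K ν) (w : BrauerHom K δ p ν.card ⊗[K] specht K ν) :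
    preCellForm K δ p ν (preCellMap ν h z) w =
      preCellForm K δ r ν z (preCellMap ν (BrauerHom.flip h) w) := by
  induction z using TensorProduct.induction_on with
  | zero => simp
  | add z₁ z₂ h₁ h₂ => rw [map_add, map_add, map_add, LinearMap.add_apply, h₁, h₂,
      LinearMap.add_apply]
  | tmul x s =>
    induction w using TensorProduct.induction_on with
    | zero => simp
    | add w₁ w₂ h₁ h₂ => rw [map_add, map_add, map_add, h₁, h₂]
    | tmul y u =>
      rw [preCellMap_tmul, preCellMap_tmul, preCellForm_tmul, preCellForm_tmul,
        BrauerHom.flip_comp, BrauerHom.comp_assoc]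

theorem cellForm_cellMap (h : BrauerHom K δ p r) (z : CellModule K δ r ν)
    (w : CellModule K δ p ν) :
    cellForm K δ p ν (cellMap ν h z) w =
      cellForm K δ r ν z (cellMap ν (BrauerHom.flip h) w) := by
  obtain ⟨z, rfl⟩ := Submodule.Quotient.mk_surjective _ z
  obtain ⟨w, rfl⟩ := Submodule.Quotient.mk_surjective _ w
  rw [cellMap_mk, cellMap_mk, cellForm_mk, cellForm_mk, preCellForm_preCellMap]

theorem cellMap_mem_cellRadical (h : BrauerHom K δ p r) {z : CellModule K δ r ν}
    (hz : z ∈ cellRadical K δ r ν) : cellMap ν h z ∈ cellRadical K δ p ν := fun w => by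
  rw [cellForm_cellMap]
  exact hz _

/-- Composition with a morphism from `r` to `p` points, as a map from `L_r(ν)` to `L_p(ν)`. -/
noncomputable def headMap (ν : YoungDiagram) (h : BrauerHom K δ p r) :
    CellHead K δ r ν →+ CellHead K δ p ν :=
  QuotientAddGroup.map (cellRadical K δ r ν).toAddSubgroup (cellRadical K δ p ν).toAddSubgroup
    (cellMap ν h) fun _ hz => cellMap_mem_cellRadical h hz

theorem headMap_mk (h : BrauerHom K δ p r) (z : CellModule K δ r ν) :
    headMap ν h (Submodule.Quotient.mk z) = Submodule.Quotient.mk (cellMap ν h z) := rfl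

theorem headMap_comp (h : BrauerHom K δ p q) (g : BrauerHom K δ q r) (z : CellHead K δ r ν) :
    headMap ν (BrauerHom.comp h g) z = headMap ν h (headMap ν g z) := by
  obtain ⟨z, rfl⟩ := Submodule.Quotient.mk_surjective _ z
  rw [headMap_mk, headMap_mk, headMap_mk, cellMap_comp]

theorem headMap_toHom (b : BrauerAlgebra K δ r) (z : CellHead K δ r ν) :
    headMap ν b.toHom z = b • z := by
  obtain ⟨z, rfl⟩ := Submodule.Quotient.mk_surjective _ z
  rw [headMap_mk, cellMap_toHom, Submodule.Quotient.mk_smul]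

end CellMap

/-! ### The corner cut out by the cup -/

namespace BrauerAlgebra

variable {K : Type*} [Field K] {δ : K} {r : ℕ} {ν : YoungDiagram}

/-- The map `b ↦ δ⁻¹ u b u^*` from `B_r` to `B_{r+2}`, where `u` is the cup; it is an isomorphism
onto the corner of the idempotent `δ⁻¹ u u^*`. -/
noncomputable def cornerMap (b : BrauerAlgebra K δ r) : BrauerAlgebra K δ (r + 2) :=
  toHom.symm (δ⁻¹ • BrauerHom.comp (BrauerHom.cup K δ r)
    (BrauerHom.comp (toHom b) (BrauerHom.flip (BrauerHom.cup K δ r))))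

theorem toHom_mul (a b : BrauerAlgebra K δ r) :
    toHom (a * b) = BrauerHom.comp (toHom a) (toHom b) := rfl

theorem toHom_one :
    toHom (1 : BrauerAlgebra K δ r) = BrauerHom.ofDiagram (BrauerDiagram.ofPerm 1) := rfl

theorem toHom_cornerMap (b : BrauerAlgebra K δ r) :
    toHom (cornerMap b) = δ⁻¹ • BrauerHom.comp (BrauerHom.cup K δ r)
      (BrauerHom.comp (toHom b) (BrauerHom.flip (BrauerHom.cup K δ r))) := rfl

theorem toHom_cornerMap_comp_cup (hδ : δ ≠ 0) (b : BrauerAlgebra K δ r) :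
    BrauerHom.comp (toHom (cornerMap b)) (BrauerHom.cup K δ r) =
      BrauerHom.comp (BrauerHom.cup K δ r) (toHom b) := by
  rw [toHom_cornerMap, LinearMap.map_smul₂, BrauerHom.comp_assoc, BrauerHom.comp_assoc,
    BrauerHom.flip_cup_comp_cup, map_smul, map_smul, BrauerHom.comp_one, smul_smul,
    inv_mul_cancel₀ hδ, one_smul]

theorem cornerMap_mul (hδ : δ ≠ 0) (a b : BrauerAlgebra K δ r) :
    cornerMap (a * b) = cornerMap a * cornerMap b := by
  apply toHom.injective
  rw [toHom_mul, toHom_cornerMap b, map_smul, ← BrauerHom.comp_assoc, toHom_cornerMap_comp_cup hδ,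
    toHom_cornerMap, toHom_mul, BrauerHom.comp_assoc, BrauerHom.comp_assoc]

theorem isIdempotentElem_cornerMap_one (hδ : δ ≠ 0) :
    IsIdempotentElem (cornerMap (1 : BrauerAlgebra K δ r)) := by
  rw [IsIdempotentElem, ← cornerMap_mul hδ, mul_one]

theorem exists_cornerMap_eq (a : BrauerAlgebra K δ (r + 2)) :
    ∃ c : BrauerAlgebra K δ r, cornerMap 1 * a * cornerMap 1 = cornerMap c := by
  refine ⟨toHom.symm (δ⁻¹ • BrauerHom.comp (BrauerHom.flip (BrauerHom.cup K δ r))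
    (BrauerHom.comp (toHom a) (BrauerHom.cup K δ r))), toHom.injective ?_⟩
  simp only [toHom_mul, toHom_cornerMap, toHom_one, BrauerHom.one_comp, map_smul,
    LinearMap.smul_apply, LinearEquiv.apply_symm_apply, BrauerHom.comp_assoc]

end BrauerAlgebra

section Corner

open BrauerAlgebra

variable {K : Type*} [Field K] {δ : K} {r : ℕ} {ν : YoungDiagram}

/-- If the modules `V r` form a functor on the Brauer category, then the cup, which has the left
inverse `δ⁻¹ u^*`, embeds `V r` in `V (r + 2)` as the corner of the idempotent `δ⁻¹ u u^*`. -/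
theorem isCornerModule_of_functorial (hδ : δ ≠ 0) {V : ℕ → Type*} [∀ r, AddCommGroup (V r)]
    [∀ r, Module (BrauerAlgebra K δ r) (V r)]
    (F : ∀ {p q : ℕ}, BrauerHom K δ p q → V q →+ V p)
    (hcomp : ∀ {p q r : ℕ} (h : BrauerHom K δ p q) (g : BrauerHom K δ q r) (z : V r),
      F (BrauerHom.comp h g) z = F h (F g z))
    (htoHom : ∀ {r : ℕ} (b : BrauerAlgebra K δ r) (z : V r), F b.toHom z = b • z) :
    IsCornerModule (cornerMap (1 : BrauerAlgebra K δ r)) cornerMap (F (BrauerHom.cup K δ r)) where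
  map_smul c n := by
    rw [← htoHom, ← htoHom, ← hcomp, ← hcomp, toHom_cornerMap_comp_cup hδ]
  injective := by
    refine Function.LeftInverse.injective
      (g := F (δ⁻¹ • BrauerHom.flip (BrauerHom.cup K δ r))) fun z => ?_
    rw [← hcomp, LinearMap.map_smul₂, BrauerHom.flip_cup_comp_cup, smul_smul,
      inv_mul_cancel₀ hδ, one_smul, ← toHom_one, htoHom, one_smul]
  mem_range_iff m := by
    constructor
    · rintro ⟨n, rfl⟩
      rw [← htoHom, ← hcomp, toHom_cornerMap_comp_cup hδ, toHom_one, BrauerHom.comp_one]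
    · intro h
      refine ⟨F (δ⁻¹ • BrauerHom.flip (BrauerHom.cup K δ r)) m, ?_⟩
      rw [← hcomp, map_smul]
      conv_rhs => rw [← h, ← htoHom, toHom_cornerMap, toHom_one, BrauerHom.one_comp]

theorem isCornerModule_cellMap (hδ : δ ≠ 0) :
    IsCornerModule (cornerMap (1 : BrauerAlgebra K δ r)) cornerMap
      (cellMap ν (BrauerHom.cup K δ r)) :=
  isCornerModule_of_functorial hδ (V := fun r => CellModule K δ r ν) (fun h => cellMap ν h)
    cellMap_comp cellMap_toHom

theorem isCornerModule_headMap (hδ : δ ≠ 0) :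
    IsCornerModule (cornerMap (1 : BrauerAlgebra K δ r)) cornerMap
      (headMap ν (BrauerHom.cup K δ r)) :=
  isCornerModule_of_functorial hδ (V := fun r => CellHead K δ r ν) (fun h => headMap ν h)
    headMap_comp headMap_toHom

theorem span_range_cellMap_cup (hδ : δ ≠ 0) (h : ν.card < r + 2) :
    Submodule.span (BrauerAlgebra K δ (r + 2))
      (Set.range (cellMap ν (BrauerHom.cup K δ r))) = ⊤ := by
  rw [eq_top_iff]
  rintro z -
  obtain ⟨z, rfl⟩ := Submodule.Quotient.mk_surjective _ z
  induction z using TensorProduct.induction_on with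
  | zero => exact zero_mem _
  | add z w hz hw => rw [Submodule.Quotient.mk_add]; exact add_mem hz hw
  | tmul x s =>
    induction x using BrauerHom.induction_on with
    | diagram d =>
      obtain ⟨a, x, hd⟩ := BrauerHom.exists_comp_cup_comp hδ d h
      rw [hd]
      exact Submodule.smul_mem _ (toHom.symm a)
        (Submodule.subset_span (Set.mem_range_self (Submodule.Quotient.mk (x ⊗ₜ s))))
    | zero => rw [TensorProduct.zero_tmul]; exact zero_mem _
    | add x y hx hy =>
      rw [TensorProduct.add_tmul, Submodule.Quotient.mk_add]
      exact add_mem hx hy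
    | smul c x hx =>
      rw [← TensorProduct.smul_tmul', Submodule.Quotient.mk_smul]
      exact Submodule.smul_of_tower_mem _ c hx

theorem span_range_headMap_cup (hδ : δ ≠ 0) (h : ν.card < r + 2) :
    Submodule.span (BrauerAlgebra K δ (r + 2))
      (Set.range (headMap ν (BrauerHom.cup K δ r))) = ⊤ := by
  have h1 := congrArg (Submodule.map (cellRadical K δ (r + 2) ν).mkQ)
    (span_range_cellMap_cup (K := K) hδ h)
  rw [Submodule.map_top, Submodule.range_mkQ, Submodule.map_span, ← Set.range_comp] at h1
  rw [eq_top_iff, ← h1]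
  refine Submodule.span_mono ?_
  rintro _ ⟨z, rfl⟩
  exact ⟨Submodule.Quotient.mk z, rfl⟩

/-- The form on `W_{r+2}(ν)` is contravariant and `W_{r+2}(ν)` is generated by its corner, so an
element that generates a submodule whose corner is zero in `L_{r+2}(ν)` lies in the radical. -/
theorem eq_zero_of_cornerMap_one_smul (hδ : δ ≠ 0) (h : ν.card < r + 2)
    (y : CellHead K δ (r + 2) ν)
    (hy : ∀ a : BrauerAlgebra K δ (r + 2), cornerMap (1 : BrauerAlgebra K δ r) • a • y = 0) :
    y = 0 := by
  obtain ⟨z, rfl⟩ := Submodule.Quotient.mk_surjective _ y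
  rw [Submodule.Quotient.mk_eq_zero]
  intro w
  have hw : w ∈ Submodule.span (BrauerAlgebra K δ (r + 2))
      (Set.range (cellMap ν (BrauerHom.cup K δ r))) :=
    span_range_cellMap_cup (K := K) hδ h ▸ Submodule.mem_top
  induction hw using Submodule.span_induction generalizing z with
  | zero => rw [map_zero]
  | add w w' _ _ hw hw' => rw [map_add, hw z hy, hw' z hy, add_zero]
  | smul b w _ hw =>
    have hb : b.star.star = b := BrauerHom.flip_flip (toHom b)
    rw [← hb, ← cellForm_smul]
    refine hw _ fun a => ?_
    rw [Submodule.Quotient.mk_smul, ← mul_smul a]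
    exact hy _
  | mem w hw =>
    obtain ⟨w, rfl⟩ := hw
    have h1 := hy 1
    rw [one_smul, ← Submodule.Quotient.mk_smul, Submodule.Quotient.mk_eq_zero] at h1
    have h2 := cellMap_mem_cellRadical (BrauerHom.flip (BrauerHom.cup K δ r)) h1
    rw [← cellMap_toHom, ← cellMap_comp, toHom_cornerMap, toHom_one, BrauerHom.one_comp, map_smul,
      ← BrauerHom.comp_assoc, BrauerHom.flip_cup_comp_cup, map_smul, LinearMap.smul_apply,
      smul_smul, inv_mul_cancel₀ hδ, one_smul, BrauerHom.one_comp] at h2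
    have h3 := h2 w
    rwa [cellForm_cellMap, BrauerHom.flip_flip] at h3

end Corner

theorem lemma3p3 {K : Type*} [Field K] [CharZero K] (δ : K) (hδ : δ ≠ 0) (r : ℕ)
    (μ lam : YoungDiagram) (hμ : μ ∈ cellIndex r) (hlam : lam ∈ cellIndex r) :
    IsCompositionFactor (BrauerAlgebra K δ r) (CellHead K δ r μ) (CellModule K δ r lam) ↔
      IsCompositionFactor (BrauerAlgebra K δ (r + 2)) (CellHead K δ (r + 2) μ)
        (CellModule K δ (r + 2) lam) := by
  have hμr : μ.card < r + 2 := by have := hμ.1; omega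
  have hα := isCornerModule_cellMap (r := r) (ν := lam) hδ
  have hβ := isCornerModule_headMap (r := r) (ν := μ) hδ
  have he := BrauerAlgebra.isIdempotentElem_cornerMap_one (r := r) hδ
  have hφ := BrauerAlgebra.exists_cornerMap_eq (K := K) (δ := δ) (r := r)
  have hgen := span_range_headMap_cup (K := K) hδ hμr
  have hsoc := eq_zero_of_cornerMap_one_smul (K := K) hδ hμr
  rw [isCompositionFactor_iff, isCompositionFactor_iff, hβ.isSimpleModule_iff he hφ hgen hsoc]
  exact and_congr_right fun _ => ⟨hα.exists_surjective_of_corner hβ hφ hgen hsoc,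
    hα.exists_surjective_of_ambient hβ he⟩
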